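/- Let $M$ be a smooth finite-dimensional manifold (Hausdorff, $\sigma$-compact, without boundary) and let $n\ge 1$. Conventions. $\iota_{u\wedge v}=\iota_v\iota_u$ (so $(\iota_{v_1\wedge\dots\wedge v_p}\beta)(w_1,\dots)=\beta(v_1,\dots,v_p,w_1,\dots)$), $\pounds_U=d\,\iota_U-(-1)^p\iota_U\,d$ for a $p$-vector field $U$, and $[\cdot,\cdot]$ is the Schouten–Nijenhuis bracket, normalized by $\iota_{[U,V]}=(-1)^{(p-1)q}\pounds_U\iota_V-\iota_V\pounds_U$ for multivector fields $U,V$ of orders $p,q$. For a subspace $S\subseteq\bigwedge^pT_x^*M$ put $S^{\circ,p}=\{u\in\bigwedge^pT_xM:\iota_u\alpha=0\ \forall\alpha\in S\}$. A regular graded Dirac structure of order $n$ on $M$ consists of vector subbundles $S^a\subseteq\bigwedge^aT^*M$, $1\le a\le n$, with $S^a=\langle\iota_u\alpha: u\in TM,\ \alpha\in S^{a+1}\rangle$ for $1\le a<n$, and vector bundle maps $\sharp_a:S^a\to\bigwedge^{n+1-a}TM/K_{n+1-a}$, where $K_p=(S^p)^{\circ,p}$, which are * skew-symmetric: $\iota_{\sharp_a(\alpha)}\beta=(-1)^{(n+1-a)(n+1-b)}\iota_{\sharp_b(\beta)}\alpha$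 for $\alpha\in S^a$, $\beta\in S^b$; * integrable: if $\alpha,\beta$ are (local) sections of $S^a,S^b$ with $a+b\ge n+1$, and $U,V$ are multivector fields of orders $p=n+1-a$, $q=n+1-b$ with $\sharp_a(\alpha)=U+K_p$, $\sharp_b(\beta)=V+K_q$, then $$\theta=(-1)^{(p-1)q}\pounds_U\beta+(-1)^q\pounds_V\alpha-\tfrac{(-1)^q}{2}\,d\big(\iota_V\alpha+(-1)^{pq}\iota_U\beta\big)$$ takes values in $S^{a+b-n}$ and $\sharp_{a+b-n}(\theta)=[U,V]+K_{p+q-1}$. For $U\subseteq M$ open let $\Omega^a_H(U)=\{\alpha\in\Omega^a(U): d\alpha\in S^{a+1}\}$ for $0\le a\le n-1$, and $\Omega^a_H(U)[1]=\{\Theta\in\Omega^a(U): d\Theta\in (S^1)^{\wedge(a+1)}\}$ for every $a\ge 0$, where $(S^1)^{\wedge b}$ is spanned by the products of $b$ elements of $S^1$. Put $\deg_H\alpha=(n-1)-\deg\alpha$. Let $$\widetilde\sharp_1:(S^1)^{\wedge b}\to\textstyle\bigwedge^{b-1}T^*M\otimes\bigwedge^nTM/K_n\qquad(b\ge1)$$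 be the unique map with $\iota_{\sharp_n(\alpha)}\beta=(-1)^{n+1-b}\,\iota_{\widetilde\sharp_1(\beta)}\alpha$ for all $\alpha\in S^n$, $\beta\in(S^1)^{\wedge b}$, where $\iota_{\theta\otimes u}\gamma=\theta\wedge\iota_u\gamma$. For $\alpha\in\Omega^{n-1}_H(U)$ and $\Theta\in\Omega^a_H(U)[1]$ define $$\{\alpha,\Theta\}=(-1)^{\deg_H\Theta}\,\iota_{\widetilde\sharp_1(d\Theta)}d\alpha\in\Omega^a(U),\qquad \{\Theta,\alpha\}=(-1)^{\deg_H\alpha}\,\iota_{\sharp_n(d\alpha)}d\Theta\in\Omega^a(U),$$ and let $\{\alpha,\beta\}=(-1)^{\deg_H\beta}\iota_{\sharp_{b+1}(d\beta)}d\alpha$ be the graded Poisson bracket of Hamiltonian forms $\alpha$, $\beta\in\Omega^b_H(U)$. **Theorem.** The forms $\{\alpha,\Theta\}$ and $\{\Theta,\alpha\}$ belong to $\Omega^a_H(U)[1]$; for $\alpha,\beta\in\Omega_H^{n-1}(U)$ one has $\{\alpha,\beta\}\in\Omega_H^{n-1}(U)$; and for $0\le b\le n-1$ and $\Theta\in\Omega^b_H(U)$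 one has $\Theta\in\Omega^b_H(U)[1]$ and $\{\alpha,\Theta\}$ is the graded Poisson bracket of $\alpha$ and $\Theta$. Moreover, the extended bracket has the following properties. 1. It is graded skew-symmetric: $\{\alpha,\Theta\}=-(-1)^{\deg_H\alpha\,\deg_H\Theta}\{\Theta,\alpha\}$ for $\alpha\in\Omega^{n-1}_H(U)$, $\Theta\in\Omega^a_H(U)[1]$. 2. It is invariant by symmetries: if $X$ is a vector field on $U$, $\Theta\in\Omega^a_H(U)[1]$ with $a\ge1$ and $\pounds_X\Theta=0$, then $\iota_X\Theta\in\Omega^{a-1}_H(U)[1]$ and $\{\alpha,\iota_X\Theta\}=\iota_X\{\alpha,\Theta\}$ for every $\alpha\in\Omega^{n-1}_H(U)$. 3. It satisfies the graded Jacobi identity up to an exact form: for $\alpha,\beta\in\Omega^{n-1}_H(U)$ and $\Theta\in\Omega^a_H(U)[1]$, the form $$\{\alpha,\{\beta,\Theta\}\}+\{\Theta,\{\alpha,\beta\}\}+\{\beta,\{\Theta,\alpha\}\}$$ is exact on $U$ (for $a=0$ this means that it vanishes). 4. It satisfies the graded Leibniz identity: for $\alpha\in\Omega^{n-1}_H(U)$,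 $\Theta_1\in\Omega^{a_1}_H(U)[1]$ and $\Theta_2\in\Omega^{a_2}_H(U)[1]$ one has $\Theta_1\wedge d\Theta_2\in\Omega^{a_1+a_2+1}_H(U)[1]$ and $$\{\alpha,\Theta_1\wedge d\Theta_2\}=\{\alpha,\Theta_1\}\wedge d\Theta_2+(-1)^{a_1+1}\,d\Theta_1\wedge\{\alpha,\Theta_2\}.$$ -/

import Mathlib

open scoped Manifold ContDiff TensorProduct Topology

noncomputable section

namespace GradedDirac

/-! ## Exterior algebra of a finite-dimensional vector space

`V [⋀^Fin a]→ₗ[ℝ] ℝ` is the space of `a`-covectors and `⋀[ℝ]^p V` that of `p`-vectors. -/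

section LinearAlgebra

variable {V : Type*} [AddCommGroup V] [Module ℝ V]

/-- The duality pairing `⟨u, α⟩`, with
`⟨v₁ ∧ ⋯ ∧ v_p, α⟩ = α(v₁, …, v_p)`. -/
def pairing (V : Type*) [AddCommGroup V] [Module ℝ V] (p : ℕ) :
    ⋀[ℝ]^p V →ₗ[ℝ] (V [⋀^Fin p]→ₗ[ℝ] ℝ) →ₗ[ℝ] ℝ :=
  (exteriorPower.alternatingMapLinearEquiv (R := ℝ) (M := V) (N := ℝ) (n := p)).toLinearMap.flip

/-- Exterior product `u ∧ w` of multivectors, as a bilinear map. The degree of the product is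
a variable `b` with a proof that `p + k = b`. -/
def mulVec {p k b : ℕ} (h : p + k = b) : ⋀[ℝ]^p V →ₗ[ℝ] ⋀[ℝ]^k V →ₗ[ℝ] ⋀[ℝ]^b V :=
  LinearMap.mk₂ ℝ
    (fun u w => ⟨(u : ExteriorAlgebra ℝ V) * (w : ExteriorAlgebra ℝ V),
      h ▸ SetLike.mul_mem_graded (A := fun i : ℕ => ⋀[ℝ]^i V) u.2 w.2⟩)
    (fun u u' w => Subtype.ext (by simp [add_mul]))
    (fun c u w => Subtype.ext (by simp))
    (fun u w w' => Subtype.ext (by simp [mul_add]))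
    (fun c u w => Subtype.ext (by simp))

/-- Contraction `ι_u β` of the `b`-covector `β` by the `p`-vector `u`, where `p + k = b`:
`⟨w, ι_u β⟩ = ⟨u ∧ w, β⟩` for all `k`-vectors `w`. Hence
`(ι_{v₁ ∧ ⋯ ∧ v_p} β)(w₁, …, w_k) = β(v₁, …, v_p, w₁, …, w_k)` and `ι_{u ∧ v} = ι_v ι_u`. -/
def contract {p k b : ℕ} (h : p + k = b) :
    ⋀[ℝ]^p V →ₗ[ℝ] (V [⋀^Fin b]→ₗ[ℝ] ℝ) →ₗ[ℝ] (V [⋀^Fin k]→ₗ[ℝ] ℝ) :=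
  LinearMap.mk₂ ℝ
    (fun u β => exteriorPower.alternatingMapLinearEquiv.symm
      ((exteriorPower.alternatingMapLinearEquiv β) ∘ₗ mulVec h u))
    (fun u u' β => by simp only [map_add, LinearMap.comp_add])
    (fun c u β => by simp only [map_smul, LinearMap.comp_smul])
    (fun u β β' => by simp only [map_add, LinearMap.add_comp])
    (fun c u β => by simp only [map_smul, LinearMap.smul_comp])

/-- Exterior product of covectors (sum over shuffles). The degree of the product is a variable
`c` with a proof that `a + b = c`. -/
def wedge {a b c : ℕ} (h : a + b = c) (α : V [⋀^Fin a]→ₗ[ℝ] ℝ) (β : V [⋀^Fin b]→ₗ[ℝ] ℝ) :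
    V [⋀^Fin c]→ₗ[ℝ] ℝ :=
  ((LinearMap.mul' ℝ ℝ).compAlternatingMap (α.domCoprod β)).domDomCongr
    (finSumFinEquiv.trans (finCongr h))

/-- `θ₁ ∧ ⋯ ∧ θ_a` for linear forms `θ_i`: the alternating map
`(v₁, …, v_a) ↦ det (θ_j (v_i))`. -/
def wedgeForms {a : ℕ} (θ : Fin a → (V →ₗ[ℝ] ℝ)) : V [⋀^Fin a]→ₗ[ℝ] ℝ :=
  (Matrix.detRowAlternating (R := ℝ) (n := Fin a)).compLinearMap (LinearMap.pi θ)

/-- For a subspace `S` of `⋀¹ V*`, the subspace `S^{∧ a}` of `⋀ᵃ V*` spanned by all products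
`θ₁ ∧ ⋯ ∧ θ_a` with `θ_i ∈ S`. -/
def wedgePow (S : Submodule ℝ (V [⋀^Fin 1]→ₗ[ℝ] ℝ)) (a : ℕ) :
    Submodule ℝ (V [⋀^Fin a]→ₗ[ℝ] ℝ) :=
  Submodule.span ℝ {ξ | ∃ θ : Fin a → (V →ₗ[ℝ] ℝ),
    (∀ i, AlternatingMap.ofSubsingleton ℝ V ℝ (0 : Fin 1) (θ i) ∈ S) ∧ ξ = wedgeForms θ}

/-- The pairing of `p`-vectors with a subspace `S` of the space of `p`-covectors. -/
def pairingOn {p : ℕ} (S : Submodule ℝ (V [⋀^Fin p]→ₗ[ℝ] ℝ)) :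
    ⋀[ℝ]^p V →ₗ[ℝ] Module.Dual ℝ S :=
  S.subtype.dualMap ∘ₗ pairing V p

/-- The annihilator `K_p = S^{∘,p} = {u ∈ ⋀ᵖ V : ι_u α = 0 for all α ∈ S}` of a space `S` of
`p`-covectors. -/
def annihilator {p : ℕ} (S : Submodule ℝ (V [⋀^Fin p]→ₗ[ℝ] ℝ)) : Submodule ℝ (⋀[ℝ]^p V) :=
  LinearMap.ker (pairingOn S)

theorem mem_annihilator {p : ℕ} (S : Submodule ℝ (V [⋀^Fin p]→ₗ[ℝ] ℝ)) (u : ⋀[ℝ]^p V) :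
    u ∈ annihilator S ↔ ∀ α ∈ S, pairing V p u α = 0 := by
  simp only [annihilator, LinearMap.mem_ker]
  constructor
  · intro h α hα
    exact LinearMap.congr_fun h ⟨α, hα⟩
  · intro h
    ext α
    exact h α.1 α.2

theorem pairingOn_surjective [FiniteDimensional ℝ V] {p : ℕ}
    (S : Submodule ℝ (V [⋀^Fin p]→ₗ[ℝ] ℝ)) : Function.Surjective (pairingOn S) := by
  have h1 : Function.Surjective (S.subtype.dualMap) := by
    intro φ
    obtain ⟨g, hg⟩ := LinearMap.exists_extend (p := S) φ
    exact ⟨g, hg⟩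
  have h2 : Function.Surjective (pairing V p) := by
    intro φ
    obtain ⟨u, hu⟩ := (Module.evalEquiv ℝ (⋀[ℝ]^p V)).surjective
      (φ ∘ₗ (exteriorPower.alternatingMapLinearEquiv
        (R := ℝ) (M := V) (N := ℝ) (n := p)).symm.toLinearMap)
    refine ⟨u, ?_⟩
    ext α
    have := LinearMap.congr_fun hu (exteriorPower.alternatingMapLinearEquiv α)
    simpa [pairing] using this
  exact h1.comp h2

/-- The quotient `⋀ᵖ V / K_p` is the dual of `S`. -/
def quotEquivDual [FiniteDimensional ℝ V] {p : ℕ} (S : Submodule ℝ (V [⋀^Fin p]→ₗ[ℝ] ℝ)) :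
    (⋀[ℝ]^p V ⧸ annihilator S) ≃ₗ[ℝ] Module.Dual ℝ S :=
  (pairingOn S).quotKerEquivOfSurjective (pairingOn_surjective S)

instance finiteDimensional_covectors [FiniteDimensional ℝ V] (p : ℕ) :
    FiniteDimensional ℝ (V [⋀^Fin p]→ₗ[ℝ] ℝ) :=
  Module.Finite.equiv
    (exteriorPower.alternatingMapLinearEquiv (R := ℝ) (M := V) (N := ℝ) (n := p)).symm

/-- Contraction by multivector-valued forms, `ι_{θ ⊗ [u]} γ = θ ∧ ι_u γ = (ι_u γ) θ`, for
`θ ∈ ⋀ᵃ V*`, `[u] ∈ ⋀ᵖ V / K_p` and `γ ∈ S ⊆ ⋀ᵖ V*` (so that `ι_u γ` is a scalar). It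
identifies `⋀ᵃ V* ⊗ ⋀ᵖ V / K_p` with the space of linear maps `S → ⋀ᵃ V*`. -/
def tensorContract [FiniteDimensional ℝ V] (a : ℕ) {p : ℕ}
    (S : Submodule ℝ (V [⋀^Fin p]→ₗ[ℝ] ℝ)) :
    ((V [⋀^Fin a]→ₗ[ℝ] ℝ) ⊗[ℝ] (⋀[ℝ]^p V ⧸ annihilator S)) ≃ₗ[ℝ]
      (S →ₗ[ℝ] (V [⋀^Fin a]→ₗ[ℝ] ℝ)) :=
  haveI : Module.Free ℝ S := Module.Free.of_divisionRing ℝ S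
  (TensorProduct.comm ℝ _ _).trans
    ((TensorProduct.congr (quotEquivDual S) (LinearEquiv.refl ℝ _)).trans
      (dualTensorHomEquiv ℝ S (V [⋀^Fin a]→ₗ[ℝ] ℝ)))

theorem tensorContract_tmul [FiniteDimensional ℝ V] (a : ℕ) {p : ℕ}
    (S : Submodule ℝ (V [⋀^Fin p]→ₗ[ℝ] ℝ)) (θ : V [⋀^Fin a]→ₗ[ℝ] ℝ) (u : ⋀[ℝ]^p V) (γ : S) :
    tensorContract a S (θ ⊗ₜ Submodule.Quotient.mk u) γ = pairing V p u γ • θ := by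
  have : Module.Free ℝ S := Module.Free.of_divisionRing ℝ S
  rfl

/-- Contraction of elements of `S^{∧(a+1)}` by vectors in the annihilator of `S` vanishes. -/
theorem contract_wedgePow_eq_zero {a : ℕ} (S : Submodule ℝ (V [⋀^Fin 1]→ₗ[ℝ] ℝ))
    {β : V [⋀^Fin (a + 1)]→ₗ[ℝ] ℝ} (hβ : β ∈ wedgePow S (a + 1))
    {u : ⋀[ℝ]^1 V} (hu : u ∈ annihilator S) :
    contract (Nat.add_comm 1 a) u β = 0 := by
  obtain ⟨X, rfl⟩ := (exteriorPower.oneEquiv (R := ℝ) (M := V)).symm.surjective u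
  have hX : (exteriorPower.oneEquiv (R := ℝ) (M := V)).symm X
      = exteriorPower.ιMulti ℝ 1 (fun _ => X) := by
    apply (exteriorPower.oneEquiv (R := ℝ) (M := V)).injective
    simp
  rw [hX] at hu ⊢
  rw [mem_annihilator] at hu
  induction hβ using Submodule.span_induction with
  | mem ξ hξ =>
    obtain ⟨θ, hθ, rfl⟩ := hξ
    have h0 : ∀ j, θ j X = 0 := by
      intro j
      have := hu _ (hθ j)
      simpa [pairing] using this
    ext w
    have hmul : mulVec (Nat.add_comm 1 a) (exteriorPower.ιMulti ℝ 1 (fun _ => X))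
        (exteriorPower.ιMulti ℝ a w)
        = exteriorPower.ιMulti ℝ (a + 1) (Matrix.vecCons X w) := by
      apply Subtype.ext
      simp [mulVec, Matrix.vecTail, Function.comp_def]
    change (exteriorPower.alternatingMapLinearEquiv (wedgeForms θ))
      (mulVec (Nat.add_comm 1 a) (exteriorPower.ιMulti ℝ 1 (fun _ => X))
        (exteriorPower.ιMulti ℝ a w)) = 0
    rw [hmul, exteriorPower.alternatingMapLinearEquiv_apply_ιMulti]
    apply Matrix.det_eq_zero_of_row_eq_zero (0 : Fin (a + 1))
    intro j
    simpa [Matrix.vecCons] using h0 j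
  | zero => simp
  | add x y _ _ hx hy => rw [map_add, hx, hy, add_zero]
  | smul c x _ hx => rw [map_smul, hx, smul_zero]

/-- `(β, [u]) ↦ ι_u β` for `β ∈ S^{∧(a+1)}` and `[u] ∈ V / K_1`, where `K_1` is the annihilator
of `S`. -/
def contractQuot {a : ℕ} (S : Submodule ℝ (V [⋀^Fin 1]→ₗ[ℝ] ℝ)) :
    wedgePow S (a + 1) →ₗ[ℝ] (⋀[ℝ]^1 V ⧸ annihilator S) →ₗ[ℝ] (V [⋀^Fin a]→ₗ[ℝ] ℝ) where
  toFun β := (annihilator S).liftQ ((contract (Nat.add_comm 1 a)).flip β.1)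
    (fun _ hu => contract_wedgePow_eq_zero S β.2 hu)
  map_add' β β' := by
    refine Submodule.linearMap_qext _ (LinearMap.ext fun u => ?_)
    simp
    rfl
  map_smul' c β := by
    refine Submodule.linearMap_qext _ (LinearMap.ext fun u => ?_)
    simp
    rfl

end LinearAlgebra

/-! ## Differential forms and multivector fields on a manifold

`M` is a manifold modelled on the finite-dimensional vector space `E`. Fields are functions on
all of `M`; smoothness and all conditions on them are only required on open subsets. -/

section Manifold

variable (E : Type*) [NormedAddCommGroup E] [NormedSpace ℝ E]
  (M : Type*) [TopologicalSpace M] [ChartedSpace E M]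

/-- Fields of `a`-covectors on `M`. -/
abbrev FormField (a : ℕ) : Type _ :=
  (x : M) → (TangentSpace 𝓘(ℝ, E) x) [⋀^Fin a]→ₗ[ℝ] ℝ

/-- Fields of `p`-vectors on `M`. -/
abbrev MultivectorField (p : ℕ) : Type _ :=
  (x : M) → ⋀[ℝ]^p (TangentSpace 𝓘(ℝ, E) x)

variable {E M}

instance finiteDimensional_tangentSpace [FiniteDimensional ℝ E] (x : M) :
    FiniteDimensional ℝ (TangentSpace 𝓘(ℝ, E) x) :=
  inferInstanceAs (FiniteDimensional ℝ E)

theorem continuous_alternatingMap [FiniteDimensional ℝ E] {a : ℕ} (f : E [⋀^Fin a]→ₗ[ℝ] ℝ) :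
    Continuous f := by
  have key : ∀ v : Fin a → E, f v = ∑ r : Fin a → Fin (Module.finrank ℝ E),
      (∏ i, (Module.finBasis ℝ E).repr (v i) (r i)) • f (fun i => Module.finBasis ℝ E (r i)) := by
    intro v
    conv_lhs => rw [show v = fun i => ∑ j, (Module.finBasis ℝ E).repr (v i) j •
      Module.finBasis ℝ E j from funext fun i => ((Module.finBasis ℝ E).sum_repr (v i)).symm]
    have := f.toMultilinearMap.map_sum (fun i j => (Module.finBasis ℝ E).repr (v i) j •
      Module.finBasis ℝ E j)
    refine this.trans (Finset.sum_congr rfl fun r _ => ?_)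
    exact f.toMultilinearMap.map_smul_univ _ _
  rw [show (f : (Fin a → E) → ℝ) = _ from funext key]
  refine continuous_finsetSum _ fun r _ => Continuous.fun_smul ?_ continuous_const
  refine continuous_finsetProd _ fun i _ => ?_
  have hc : Continuous ((Module.finBasis ℝ E).coord (r i)) :=
    LinearMap.continuous_of_finiteDimensional _
  exact hc.comp (continuous_apply i)

/-- An alternating map on the finite-dimensional space `E`, as a continuous one. -/
def toCont [FiniteDimensional ℝ E] {a : ℕ} (f : E [⋀^Fin a]→ₗ[ℝ] ℝ) : E [⋀^Fin a]→L[ℝ] ℝ :=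
  { f with cont := continuous_alternatingMap f }

/-- The differential at `y : E` of the inverse of the preferred chart at `x₀`. -/
def chartSymmDeriv (x₀ : M) (y : E) :
    E →ₗ[ℝ] TangentSpace 𝓘(ℝ, E) ((chartAt E x₀).symm y) :=
  (mfderiv 𝓘(ℝ, E) 𝓘(ℝ, E) (chartAt E x₀).symm y).toLinearMap

/-- The differential at `x : M` of the preferred chart at `x₀`. -/
def chartDeriv (x₀ x : M) : TangentSpace 𝓘(ℝ, E) x →ₗ[ℝ] E :=
  (mfderiv 𝓘(ℝ, E) 𝓘(ℝ, E) (chartAt E x₀) x).toLinearMap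

/-- The pullback of a field of forms by the inverse of the preferred chart at `x₀`. -/
def formInChart [FiniteDimensional ℝ E] {a : ℕ} (x₀ : M) (ξ : FormField E M a) (y : E) :
    E [⋀^Fin a]→L[ℝ] ℝ :=
  toCont ((ξ ((chartAt E x₀).symm y)).compLinearMap (chartSymmDeriv x₀ y))

/-- The pushforward of a multivector field by the preferred chart at `x₀`. -/
def multivectorInChart {p : ℕ} (x₀ : M) (u : MultivectorField E M p) (y : E) : ⋀[ℝ]^p E :=
  exteriorPower.map p (chartDeriv x₀ ((chartAt E x₀).symm y)) (u ((chartAt E x₀).symm y))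

/-- The form `ξ` is smooth on the open set `U`. -/
def SmoothForm [FiniteDimensional ℝ E] {a : ℕ} (U : Set M) (ξ : FormField E M a) : Prop :=
  ∀ x ∈ U, ContDiffAt ℝ ∞ (formInChart x ξ) (chartAt E x x)

/-- The multivector field `u` is smooth on the open set `U`: its coordinates in charts are
smooth functions. -/
def SmoothMultivector {p : ℕ} (U : Set M) (u : MultivectorField E M p) : Prop :=
  ∀ x ∈ U, ∀ η : E [⋀^Fin p]→ₗ[ℝ] ℝ,
    ContDiffAt ℝ ∞ (fun y => pairing E p (multivectorInChart x u y) η) (chartAt E x x)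

/-- The vector field `X` is smooth on the open set `U`. -/
def SmoothVectorField [IsManifold 𝓘(ℝ, E) ∞ M] (U : Set M) (X : (x : M) → TangentSpace 𝓘(ℝ, E) x) : Prop :=
  ContMDiffOn 𝓘(ℝ, E) 𝓘(ℝ, E).tangent ∞ (fun x => (⟨x, X x⟩ : TangentBundle 𝓘(ℝ, E) M)) U

/-- The exterior derivative, computed in the preferred chart at each point. -/
def extD [FiniteDimensional ℝ E] {a : ℕ} (ξ : FormField E M a) : FormField E M (a + 1) :=
  fun x => (extDeriv (formInChart x ξ) (chartAt E x x)).toAlternatingMap.compLinearMap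
    (chartDeriv x x)

/-- Contraction of a field of forms by a multivector field. -/
def iota {p k b : ℕ} (h : p + k = b) (u : MultivectorField E M p) (β : FormField E M b) :
    FormField E M k :=
  fun x => contract h (u x) (β x)

/-- Contraction `ι_X β` by a vector field, `(ι_X β)(w₁, …) = β(X, w₁, …)`. -/
def iotaVec {k : ℕ} (X : (x : M) → TangentSpace 𝓘(ℝ, E) x) (β : FormField E M (k + 1)) :
    FormField E M k :=
  fun x => (β x).curryLeft (X x)

/-- Exterior product of fields of forms. -/
def wedgeForm {a b c : ℕ} (h : a + b = c) (α : FormField E M a) (β : FormField E M b) :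
    FormField E M c :=
  fun x => wedge h (α x) (β x)

/-- The Lie derivative `£_u β = d ι_u β - (-1)^p ι_u dβ` of a `b`-form along a `p`-vector field.
Its degree is `c = b + 1 - p`; the first summand is zero when `b < p`, that is `c = 0`. -/
def lieD [FiniteDimensional ℝ E] {p b : ℕ} : (c : ℕ) → (h : p + c = b + 1) →
    MultivectorField E M p → FormField E M b → FormField E M c
  | 0, h, u, β => -((-1 : ℝ) ^ p • iota h u (extD β))
  | k + 1, h, u, β =>
      extD (iota (Nat.succ_injective h : p + k = b) u β) - (-1 : ℝ) ^ p • iota h u (extD β)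

/-- The Lie derivative `£_X β = d ι_X β + ι_X dβ` along a vector field, on forms of positive
degree. -/
def lieDVec [FiniteDimensional ℝ E] {b : ℕ} (X : (x : M) → TangentSpace 𝓘(ℝ, E) x)
    (β : FormField E M (b + 1)) : FormField E M (b + 1) :=
  extD (iotaVec X β) + iotaVec X (extD β)

/-- The Schouten-Nijenhuis bracket `[u, v]` of a `p`-vector field `u` and a `q`-vector field `v`
with `p, q ≥ 1`: the field of `(p + q - 1)`-vectors determined by
`ι_{[u,v]} α = (-1)^{(p-1)q} £_u ι_v α - ι_v £_u α`.
As a `r`-vector, `r = p + q - 1`, is determined by its contractions with `r`-forms, it is enough to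
let `α` range over the `r`-forms defined and smooth near the point. With this convention
`[X₁ ∧ ⋯ ∧ X_p, Y₁ ∧ ⋯ ∧ Y_q]
  = ∑ (-1)^{i+j} [X_i, Y_j] ∧ X₁ ∧ ⋯ X̂_i ⋯ ∧ X_p ∧ Y₁ ∧ ⋯ Ŷ_j ⋯ ∧ Y_q`. -/
def schouten [FiniteDimensional ℝ E] {p q r : ℕ} (hp : 1 ≤ p) (hr : p + q = r + 1)
    (u : MultivectorField E M p) (v : MultivectorField E M q) : MultivectorField E M r :=
  fun x => Classical.epsilon fun w : ⋀[ℝ]^r (TangentSpace 𝓘(ℝ, E) x) =>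
    ∀ W : Set M, IsOpen W → x ∈ W → ∀ α : FormField E M r, SmoothForm W α →
      contract (Nat.add_zero r) w (α x) =
        (-1 : ℝ) ^ ((p - 1) * q) •
            lieD (b := p - 1) 0 (by omega) u (iota (by omega : q + (p - 1) = r) v α) x
          - contract (Nat.add_zero q) (v x) (lieD q hr u α x)

/-- A family of subspaces `S x ⊆ ⋀ᵃ T*_x M` is a smooth vector subbundle: it has smooth local
frames. -/
def IsSubbundle [FiniteDimensional ℝ E] {a : ℕ}
    (S : (x : M) → Submodule ℝ ((TangentSpace 𝓘(ℝ, E) x) [⋀^Fin a]→ₗ[ℝ] ℝ)) : Prop :=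
  ∀ x : M, ∃ W : Set M, IsOpen W ∧ x ∈ W ∧ ∃ (r : ℕ) (σ : Fin r → FormField E M a),
    (∀ i, SmoothForm W (σ i)) ∧
    ∀ y ∈ W, LinearIndependent ℝ (fun i => σ i y) ∧
      S y = Submodule.span ℝ (Set.range fun i => σ i y)

/-- The form `ξ` is exact on `U`. A `0`-form is exact if and only if it vanishes. -/
def IsExactForm [FiniteDimensional ℝ E] (U : Set M) : {a : ℕ} → FormField E M a → Prop
  | 0, ξ => ∀ x ∈ U, ξ x = 0
  | a + 1, ξ => ∃ η : FormField E M a, SmoothForm U η ∧ ∀ x ∈ U, ξ x = extD η x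

end Manifold

/-! ## Regular graded Dirac structures -/

section Dirac

/-- A regular graded Dirac structure of order `n` on `M`: vector subbundles
`S¹, …, Sⁿ` of `⋀¹M, …, ⋀ⁿM` related by contractions, and vector bundle maps
`♯_a : Sᵃ → ⋁_p M / K_p`, `p = n + 1 - a`, which are skew-symmetric and integrable. Only the values
`S a` with `1 ≤ a ≤ n` are relevant. -/
structure RegularGradedDirac (E : Type*) [NormedAddCommGroup E] [NormedSpace ℝ E]
    [FiniteDimensional ℝ E] (M : Type*) [TopologicalSpace M] [ChartedSpace E M] (n : ℕ) where
  /-- the fibres of the subbundles -/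
  S : (a : ℕ) → (x : M) → Submodule ℝ ((TangentSpace 𝓘(ℝ, E) x) [⋀^Fin a]→ₗ[ℝ] ℝ)
  isSubbundle : ∀ a, 1 ≤ a → a ≤ n → IsSubbundle (S a)
  /-- `Sᵃ = ι_{TM} S^{a+1}` -/
  contraction : ∀ a, 1 ≤ a → a < n → ∀ x : M,
    S a x = Submodule.span ℝ
      {β | ∃ (X : TangentSpace 𝓘(ℝ, E) x), ∃ α ∈ S (a + 1) x, β = α.curryLeft X}
  /-- the maps `♯_a` on fibres -/
  sharp : ∀ {a p : ℕ}, 1 ≤ a → 1 ≤ p → a + p = n + 1 → ∀ x : M,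
    S a x →ₗ[ℝ] (⋀[ℝ]^p (TangentSpace 𝓘(ℝ, E) x) ⧸ annihilator (S p x))
  /-- `♯_a` is smooth: it sends smooth local sections of `Sᵃ` to classes which locally have
  smooth representatives -/
  sharp_smooth : ∀ {a p : ℕ} (ha : 1 ≤ a) (hp : 1 ≤ p) (h : a + p = n + 1) (U : Set M),
    IsOpen U → ∀ α : FormField E M a, SmoothForm U α → ∀ hα : ∀ y ∈ U, α y ∈ S a y,
      ∀ x ∈ U, ∃ W : Set M, IsOpen W ∧ x ∈ W ∧ ∃ hWU : W ⊆ U,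
        ∃ u : MultivectorField E M p, SmoothMultivector W u ∧
          ∀ y (hy : y ∈ W), sharp ha hp h y ⟨α y, hα y (hWU hy)⟩ = Submodule.Quotient.mk (u y)
  /-- skew-symmetry `ι_{♯_a α} β = (-1)^{pq} ι_{♯_b β} α`, with `p = n + 1 - a`, `q = n + 1 - b`; `k`
  is the common degree `a + b - n - 1` of both sides (if it is negative, both sides are zero). The
  contractions do not depend on the representatives `u`, `v`. -/
  skew : ∀ {a b p q k : ℕ} (ha : 1 ≤ a) (hb : 1 ≤ b) (hp : 1 ≤ p) (hq : 1 ≤ q)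
    (hap : a + p = n + 1) (hbq : b + q = n + 1) (hpk : p + k = b) (hqk : q + k = a) (x : M)
    (α : S a x) (β : S b x) (u : ⋀[ℝ]^p (TangentSpace 𝓘(ℝ, E) x))
    (v : ⋀[ℝ]^q (TangentSpace 𝓘(ℝ, E) x)),
    sharp ha hp hap x α = Submodule.Quotient.mk u →
    sharp hb hq hbq x β = Submodule.Quotient.mk v →
      contract hpk u β.1 = (-1 : ℝ) ^ (p * q) • contract hqk v α.1
  /-- integrability, for sections `α` of `Sᵃ` and `β` of `Sᵇ` over an open set `W`, with
  `a + b - n = k + 1 ≥ 1`, and multivector fields `u`, `v` representing `♯_a α` and `♯_b β`: the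
  `(k+1)`-form
  `θ = (-1)^{(p-1)q} £_u β + (-1)^q £_v α - (-1)^q/2 d(ι_v α + (-1)^{pq} ι_u β)`
  takes values in `S^{k+1}`, and `♯_{k+1} θ = [u, v] + K_{p+q-1}`. -/
  integrable : ∀ {a b p q k r : ℕ} (ha : 1 ≤ a) (hb : 1 ≤ b) (hp : 1 ≤ p) (hq : 1 ≤ q)
    (hap : a + p = n + 1) (hbq : b + q = n + 1) (hpk : p + k = b) (hqk : q + k = a)
    (hr : p + q = r + 1) (W : Set M), IsOpen W →
    ∀ (α : FormField E M a) (β : FormField E M b) (u : MultivectorField E M p)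
      (v : MultivectorField E M q),
    SmoothForm W α → SmoothForm W β → SmoothMultivector W u → SmoothMultivector W v →
    ∀ (hα : ∀ x ∈ W, α x ∈ S a x) (hβ : ∀ x ∈ W, β x ∈ S b x),
    (∀ x (hx : x ∈ W), sharp ha hp hap x ⟨α x, hα x hx⟩ = Submodule.Quotient.mk (u x)) →
    (∀ x (hx : x ∈ W), sharp hb hq hbq x ⟨β x, hβ x hx⟩ = Submodule.Quotient.mk (v x)) →
    ∀ θ : FormField E M (k + 1),
      θ = (-1 : ℝ) ^ ((p - 1) * q) • lieD (k + 1) (by omega) u β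
          + (-1 : ℝ) ^ q • lieD (k + 1) (by omega) v α
          - ((-1 : ℝ) ^ q / 2) • extD (iota hqk v α + (-1 : ℝ) ^ (p * q) • iota hpk u β) →
      ∀ x ∈ W, ∃ hθ : θ x ∈ S (k + 1) x,
        sharp (p := r) (by omega) (by omega) (by omega) x ⟨θ x, hθ⟩
          = Submodule.Quotient.mk (schouten hp hr u v x)

variable {E : Type*} [NormedAddCommGroup E] [NormedSpace ℝ E] [FiniteDimensional ℝ E]
  {M : Type*} [TopologicalSpace M] [ChartedSpace E M]

/-- `deg_H α = (n - 1) - deg α`. -/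
def degH (n a : ℕ) : ℤ := (n : ℤ) - 1 - a

namespace RegularGradedDirac

/-- `α ∈ Ωᵃ_H(U)`: `α` is an `a`-form on `U` with `dα` taking values in `S^{a+1}`. -/
def IsHamiltonian {n : ℕ} (D : RegularGradedDirac E M n) (U : Set M) {a : ℕ}
    (α : FormField E M a) : Prop :=
  SmoothForm U α ∧ ∀ x ∈ U, extD α x ∈ D.S (a + 1) x

/-- `Θ ∈ Ωᵃ_H(U)[1]`: `Θ` is an `a`-form on `U` with `dΘ` taking values in `(S¹)^{∧(a+1)}`. -/
def IsHamiltonianOne {n : ℕ} (D : RegularGradedDirac E M n) (U : Set M) {a : ℕ}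
    (Θ : FormField E M a) : Prop :=
  SmoothForm U Θ ∧ ∀ x ∈ U, extD Θ x ∈ wedgePow (D.S 1 x) (a + 1)

/-- The map `(β, α) ↦ ι_{♯_n α} β` for `β ∈ (S¹)^{∧(a+1)}` and `α ∈ Sⁿ`. -/
def contractSharp {n : ℕ} (hn : 1 ≤ n) (D : RegularGradedDirac E M n) (a : ℕ) (x : M) :
    wedgePow (D.S 1 x) (a + 1) →ₗ[ℝ]
      D.S n x →ₗ[ℝ] ((TangentSpace 𝓘(ℝ, E) x) [⋀^Fin a]→ₗ[ℝ] ℝ) :=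
  (LinearMap.lcomp ℝ _ (D.sharp hn le_rfl rfl x)) ∘ₗ contractQuot (D.S 1 x)

/-- The canonical extension
`♯̃_1 : (S¹)^{∧(a+1)} → ⋀ᵃ M ⊗ ⋁_n M / K_n` of `♯_1`: the unique map with
`ι_{♯_n α} β = (-1)^{n+1-(a+1)} ι_{♯̃_1 β} α` for `α ∈ Sⁿ`, `β ∈ (S¹)^{∧(a+1)}`. -/
def sharpOneExt {n : ℕ} (hn : 1 ≤ n) (D : RegularGradedDirac E M n) (a : ℕ) (x : M) :
    wedgePow (D.S 1 x) (a + 1) →ₗ[ℝ]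
      (((TangentSpace 𝓘(ℝ, E) x) [⋀^Fin a]→ₗ[ℝ] ℝ) ⊗[ℝ]
        (⋀[ℝ]^n (TangentSpace 𝓘(ℝ, E) x) ⧸ annihilator (D.S n x))) :=
  (tensorContract a (D.S n x)).symm.toLinearMap ∘ₗ
    ((-1 : ℝ) ^ ((n : ℤ) + 1 - ((a : ℤ) + 1)) • D.contractSharp hn a x)

/-- The defining property of `♯̃_1`. -/
theorem contractSharp_eq {n : ℕ} (hn : 1 ≤ n) (D : RegularGradedDirac E M n) (a : ℕ) (x : M)
    (β : wedgePow (D.S 1 x) (a + 1)) (α : D.S n x) :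
    D.contractSharp hn a x β α = (-1 : ℝ) ^ ((n : ℤ) + 1 - ((a : ℤ) + 1)) •
      tensorContract a (D.S n x) (D.sharpOneExt hn a x β) α := by
  simp only [sharpOneExt, LinearMap.comp_apply, LinearEquiv.coe_coe,
    LinearEquiv.apply_symm_apply, LinearMap.smul_apply, smul_smul]
  rw [← mul_zpow]
  simp

open Classical in
/-- The extended bracket `{α, Θ} = (-1)^{deg_H Θ} ι_{♯̃_1(dΘ)} dα` of `α ∈ Ω^{n-1}_H` and
`Θ ∈ Ωᵃ_H[1]`, for order `n = m + 1` (with value zero at the points where `dα` is not in `Sⁿ` or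
`dΘ` is not in `(S¹)^{∧(a+1)}`). -/
def extBracket {m : ℕ} (D : RegularGradedDirac E M (m + 1)) {a : ℕ}
    (α : FormField E M m) (Θ : FormField E M a) : FormField E M a :=
  fun x =>
    if h : extD α x ∈ D.S (m + 1) x ∧ extD Θ x ∈ wedgePow (D.S 1 x) (a + 1) then
      (-1 : ℝ) ^ degH (m + 1) a •
        tensorContract a (D.S (m + 1) x)
          (D.sharpOneExt (Nat.le_add_left 1 m) a x ⟨extD Θ x, h.2⟩) ⟨extD α x, h.1⟩
    else 0

open Classical in
/-- The bracket `{Θ, β} = (-1)^{deg_H β} ι_{♯_{b+1}(dβ)} dΘ` of an `a`-form `Θ` with a Hamiltonian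
`b`-form `β` (with value zero at the points where `dβ` is not in `S^{b+1}`). Here
`p = n + 1 - (b + 1)` and `k = a + b - (n - 1)` is the degree of the bracket. For `Θ ∈ Ωᵃ_H` it is the
graded Poisson bracket of Hamiltonian forms, and for `b = n - 1` it is also used for
`Θ ∈ Ωᵃ_H[1]`. In both cases the contraction does not depend on the representative of the class
`♯_{b+1}(dβ)`. -/
def poisson {n : ℕ} (D : RegularGradedDirac E M n) {a b p k : ℕ} (hp : 1 ≤ p)
    (hbp : (b + 1) + p = n + 1) (hk : p + k = a + 1)
    (Θ : FormField E M a) (β : FormField E M b) : FormField E M k :=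
  fun x =>
    if h : extD β x ∈ D.S (b + 1) x then
      (-1 : ℝ) ^ degH n b •
        contract hk (Quotient.out (D.sharp (Nat.le_add_left 1 b) hp hbp x ⟨extD β x, h⟩))
          (extD Θ x)
    else 0

/-- The bracket `{Θ, β}` for `β ∈ Ω^{n-1}_H`, in order `n = m + 1`. -/
abbrev poissonTop {m : ℕ} (D : RegularGradedDirac E M (m + 1)) {a : ℕ}
    (Θ : FormField E M a) (β : FormField E M m) : FormField E M a :=
  D.poisson (p := 1) le_rfl rfl (Nat.add_comm 1 a) Θ β

end RegularGradedDirac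

end Dirac

end GradedDirac

end

/-!
# The graded Poisson bracket extended to forms with `dΘ ∈ (S¹)^{∧(a+1)}`

Let `K` be the common kernel of the elements of `S¹`. A form of positive degree lies in a power of
`S¹` if and only if its contractions with the vectors of `K` vanish (`mem_wedgePow_succ_iff`).
Hence, for a Hamiltonian `(n-1)`-form `α`, the contraction of `dΘ` with a Hamiltonian vector `X_α`
representing `♯_n(dα)` does not depend on the representative. Unfolding the definition of `♯̃_1`, the
extended brackets are `{Θ, α} = ι_{X_α} dΘ` and `{α, Θ} = -ι_{X_α} dΘ` (`poissonTop_eq`,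
`extBracket_apply`). Skew-symmetry, the invariance by symmetries and the Leibniz identity then follow
from the fact that contractions anticommute and are antiderivations of the exterior product
(`curryLeft_anticomm`, `curryLeft_wedge`). Skew-symmetry of the maps `♯_a` gives the comparison with
the Poisson bracket, since `S^{c+1}` is contained in the `(c+1)`-st power of `S¹`
(`mem_wedgePow_of_mem`).

The differential input is integrability. As `dα` is closed, the form `θ` attached to `dα` and a
section `β` of `S^{k+1}` reduces to `£_{X_α} β` (`lieDVec_mem`).

* For `β` in a frame of `S¹`, this says that `£_{X_α}` preserves the sections of `S¹`. Extending a
  vector of `K` to a local section of the kernels (`exists_section_kernel`), one sees that it also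
  preserves the forms killed by these kernels (`curryLeft_lieDVec_eq_zero`). As
  `d{Θ, α} = £_{X_α} dΘ`, the brackets stay in the space `Ω_H[1]`.
* For `β` the differential of another Hamiltonian `(n-1)`-form, it says that the bracket of the two
  forms is Hamiltonian, with a Schouten-Nijenhuis bracket as Hamiltonian vector field
  (`sharp_extD_poissonTop`).

For the Jacobi identity put `X = X_β`, `Y = X_α`. By the above the cyclic sum is
`ι_Y d ι_X dΘ + ι_{[X, Y]} dΘ - ι_X d ι_Y dΘ`, and `ι_{[X, Y]} = £_X ι_Y - ι_Y £_X` together with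
Cartan's formula turns it into `d ι_X ι_Y dΘ`, which is zero if `Θ` is a function
(`isExactForm_jacobi_sum`).

Forms on the manifold are handled through their expressions in charts: Mathlib's exterior derivative
on a vector space is transported by `formInChart_extD`, which rests on its naturality under the
transition maps.
-/

noncomputable section

namespace GradedDirac

/-! ### Vectors as `1`-vectors, and the kernel of a space of `1`-forms -/

section Algebra

variable {V W : Type*} [AddCommGroup V] [Module ℝ V] [AddCommGroup W] [Module ℝ W]

/-- The identification of `1`-vectors with vectors. -/
abbrev toVec : ⋀[ℝ]^1 V ≃ₗ[ℝ] V := exteriorPower.oneEquiv ℝ V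

theorem toVec_symm_apply (X : V) : toVec.symm X = exteriorPower.ιMulti ℝ 1 (fun _ => X) := by
  apply (toVec (V := V)).injective
  simp

theorem contract_one {k : ℕ} (h : 1 + k = k + 1) (u : ⋀[ℝ]^1 V) (β : V [⋀^Fin (k + 1)]→ₗ[ℝ] ℝ) :
    contract h u β = β.curryLeft (toVec u) := by
  obtain ⟨X, rfl⟩ := (toVec (V := V)).symm.surjective u
  rw [LinearEquiv.apply_symm_apply, toVec_symm_apply]
  ext w
  have hmul : mulVec h (exteriorPower.ιMulti ℝ 1 (fun _ => X)) (exteriorPower.ιMulti ℝ k w)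
      = exteriorPower.ιMulti ℝ (k + 1) (Matrix.vecCons X w) := by
    apply Subtype.ext
    simp [mulVec, Matrix.vecTail, Function.comp_def]
  change (exteriorPower.alternatingMapLinearEquiv β)
      (mulVec h (exteriorPower.ιMulti ℝ 1 (fun _ => X)) (exteriorPower.ιMulti ℝ k w)) = _
  rw [hmul, exteriorPower.alternatingMapLinearEquiv_apply_ιMulti]
  rfl

theorem pairing_one (u : ⋀[ℝ]^1 V) (β : V [⋀^Fin 1]→ₗ[ℝ] ℝ) :
    pairing V 1 u β = β fun _ => toVec u := by
  obtain ⟨X, rfl⟩ := (toVec (V := V)).symm.surjective u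
  rw [LinearEquiv.apply_symm_apply, toVec_symm_apply]
  simp [pairing]

/-- The vectors on which all elements of a space `S` of `1`-covectors vanish. -/
def kerVec (S : Submodule ℝ (V [⋀^Fin 1]→ₗ[ℝ] ℝ)) : Submodule ℝ V :=
  (annihilator S).map (toVec (V := V)).toLinearMap

theorem mem_kerVec {S : Submodule ℝ (V [⋀^Fin 1]→ₗ[ℝ] ℝ)} {X : V} :
    X ∈ kerVec S ↔ ∀ σ ∈ S, (σ fun _ => X) = 0 := by
  constructor
  · rintro ⟨u, hu, rfl⟩ σ hσ
    rw [← (mem_annihilator S u).1 hu σ hσ, pairing_one]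
    rfl
  · intro h
    refine ⟨toVec.symm X, (mem_annihilator S _).2 fun σ hσ => ?_, by simp⟩
    rw [pairing_one, LinearEquiv.apply_symm_apply, h σ hσ]

theorem quotient_mk_eq_iff_kerVec {S : Submodule ℝ (V [⋀^Fin 1]→ₗ[ℝ] ℝ)} {u v : ⋀[ℝ]^1 V} :
    (Submodule.Quotient.mk u : ⋀[ℝ]^1 V ⧸ annihilator S) = Submodule.Quotient.mk v ↔
      toVec u - toVec v ∈ kerVec S := by
  rw [Submodule.Quotient.eq, ← map_sub, mem_kerVec, mem_annihilator]
  simp only [pairing_one]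

/-! ### Left multiplication by a `1`-form -/

/-- Exterior product `φ ∧ γ` of a linear form `φ` with an alternating map `γ`. -/
def mulLeft {a : ℕ} (φ : V →ₗ[ℝ] ℝ) :
    (V [⋀^Fin a]→ₗ[ℝ] ℝ) →ₗ[ℝ] (V [⋀^Fin (a + 1)]→ₗ[ℝ] ℝ) :=
  AlternatingMap.alternatizeUncurryFinLM ∘ₗ LinearMap.smulRightₗ φ

theorem mulLeft_apply {a : ℕ} (φ : V →ₗ[ℝ] ℝ) (γ : V [⋀^Fin a]→ₗ[ℝ] ℝ) :
    mulLeft φ γ = AlternatingMap.alternatizeUncurryFin (φ.smulRight γ) := rfl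

theorem vecCons_removeNth_succ {A : Type*} {n : ℕ} (X : A) (v : Fin (n + 1) → A) (i : Fin (n + 1)) :
    (i.succ).removeNth (Matrix.vecCons X v : Fin (n + 2) → A)
      = Matrix.vecCons X (i.removeNth v) := by
  ext j
  cases j using Fin.cases with
  | zero => simp [Fin.removeNth]
  | succ j => simp [Fin.removeNth]

theorem curryLeft_alternatizeUncurryFin_zero (f : V →ₗ[ℝ] V [⋀^Fin 0]→ₗ[ℝ] ℝ) (X : V) :
    (AlternatingMap.alternatizeUncurryFin f).curryLeft X = f X := by
  ext v
  simp [AlternatingMap.alternatizeUncurryFin_apply]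

/-- `ι_X` of the alternatization of `f`: the contraction anticommutes with the alternatization
up to the term where `X` is inserted in the distinguished slot. -/
theorem curryLeft_alternatizeUncurryFin_succ {n : ℕ} (f : V →ₗ[ℝ] V [⋀^Fin (n + 1)]→ₗ[ℝ] ℝ)
    (X : V) :
    (AlternatingMap.alternatizeUncurryFin f).curryLeft X =
      f X - AlternatingMap.alternatizeUncurryFin
        ((AlternatingMap.curryLeftLinearMap.flip X) ∘ₗ f) := by
  ext v
  rw [AlternatingMap.curryLeft_apply_apply, AlternatingMap.alternatizeUncurryFin_apply,
    Fin.sum_univ_succ, AlternatingMap.sub_apply, AlternatingMap.alternatizeUncurryFin_apply,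
    sub_eq_add_neg, ← Finset.sum_neg_distrib]
  congr 1
  · simp
  · refine Finset.sum_congr rfl fun i _ => ?_
    rw [vecCons_removeNth_succ]
    simp [pow_succ]

theorem curryLeft_mulLeft_zero (φ : V →ₗ[ℝ] ℝ) (γ : V [⋀^Fin 0]→ₗ[ℝ] ℝ) (X : V) :
    (mulLeft φ γ).curryLeft X = φ X • γ := by
  rw [mulLeft_apply, curryLeft_alternatizeUncurryFin_zero]; rfl

theorem curryLeft_mulLeft_succ {n : ℕ} (φ : V →ₗ[ℝ] ℝ) (γ : V [⋀^Fin (n + 1)]→ₗ[ℝ] ℝ) (X : V) :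
    (mulLeft φ γ).curryLeft X = φ X • γ - mulLeft φ (γ.curryLeft X) := by
  rw [mulLeft_apply, curryLeft_alternatizeUncurryFin_succ]
  congr 1

/-- `φ ∧ φ ∧ γ = 0`: the alternatization of a symmetric bilinear expression vanishes. -/
theorem mulLeft_mulLeft_self {n : ℕ} (φ : V →ₗ[ℝ] ℝ) (γ : V [⋀^Fin n]→ₗ[ℝ] ℝ) :
    mulLeft φ (mulLeft φ γ) = 0 := by
  have := AlternatingMap.alternatizeUncurryFin_alternatizeUncurryFinLM_comp_of_symmetric
    (f := φ.smulRight (φ.smulRight γ)) (by intro x y; simp [smul_smul, mul_comm])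
  rw [← this, mulLeft_apply]
  congr 1
  ext w : 1
  simp [mulLeft_apply]

theorem mulLeft_add_left {n : ℕ} (φ ψ : V →ₗ[ℝ] ℝ) (γ : V [⋀^Fin n]→ₗ[ℝ] ℝ) :
    mulLeft (φ + ψ) γ = mulLeft φ γ + mulLeft ψ γ := by
  simp only [mulLeft_apply, ← AlternatingMap.alternatizeUncurryFin_add]
  congr 1
  ext w : 1
  simp [add_smul]

theorem mulLeft_anticomm {n : ℕ} (φ ψ : V →ₗ[ℝ] ℝ) (γ : V [⋀^Fin n]→ₗ[ℝ] ℝ) :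
    mulLeft ψ (mulLeft φ γ) = -mulLeft φ (mulLeft ψ γ) := by
  have h := mulLeft_mulLeft_self (φ + ψ) γ
  simp only [mulLeft_add_left, map_add, mulLeft_mulLeft_self, zero_add, add_zero] at h
  exact eq_neg_of_add_eq_zero_left h

/-- The Laplace expansion of the determinant along its first column. -/
theorem wedgeForms_cons {a : ℕ} (φ : V →ₗ[ℝ] ℝ) (θ : Fin a → (V →ₗ[ℝ] ℝ)) :
    wedgeForms (Fin.cons φ θ : Fin (a + 1) → (V →ₗ[ℝ] ℝ)) = mulLeft φ (wedgeForms θ) := by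
  ext v
  rw [mulLeft_apply, AlternatingMap.alternatizeUncurryFin_apply]
  change Matrix.det (Matrix.of fun i j => (Fin.cons φ θ : Fin (a + 1) → (V →ₗ[ℝ] ℝ)) j (v i)) = _
  rw [Matrix.det_succ_column_zero]
  refine Finset.sum_congr rfl fun i _ => ?_
  simp only [LinearMap.smulRight_apply, AlternatingMap.smul_apply, smul_eq_mul, mul_assoc]
  rw [zsmul_eq_mul]
  push_cast
  rfl

theorem wedgeForms_zero_apply (θ : Fin 0 → (V →ₗ[ℝ] ℝ)) (v : Fin 0 → V) : wedgeForms θ v = 1 := by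
  change Matrix.det (Matrix.of fun i j => θ j (v i)) = _
  simp

theorem wedgeForms_comp {a : ℕ} (θ : Fin a → (V →ₗ[ℝ] ℝ)) (f : W →ₗ[ℝ] V) :
    (wedgeForms θ).compLinearMap f = wedgeForms fun i => θ i ∘ₗ f := rfl

theorem mulLeft_mem_wedgePow {S : Submodule ℝ (V [⋀^Fin 1]→ₗ[ℝ] ℝ)} {a : ℕ} {φ : V →ₗ[ℝ] ℝ}
    (hφ : AlternatingMap.ofSubsingleton ℝ V ℝ (0 : Fin 1) φ ∈ S)
    {γ : V [⋀^Fin a]→ₗ[ℝ] ℝ} (hγ : γ ∈ wedgePow S a) : mulLeft φ γ ∈ wedgePow S (a + 1) := by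
  induction hγ using Submodule.span_induction with
  | mem ξ hξ =>
    obtain ⟨θ, hθ, rfl⟩ := hξ
    refine Submodule.subset_span ⟨Fin.cons φ θ, fun i => ?_, (wedgeForms_cons φ θ).symm⟩
    cases i using Fin.cases with
    | zero => exact hφ
    | succ i => exact hθ i
  | zero => simp
  | add x y _ _ hx hy => rw [map_add]; exact add_mem hx hy
  | smul c x _ hx => rw [map_smul]; exact Submodule.smul_mem _ _ hx

theorem mem_wedgePow_zero (S : Submodule ℝ (V [⋀^Fin 1]→ₗ[ℝ] ℝ)) (β : V [⋀^Fin 0]→ₗ[ℝ] ℝ) :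
    β ∈ wedgePow S 0 := by
  have : β = β 0 • wedgeForms (fun i : Fin 0 => i.elim0) := by
    ext v
    rw [AlternatingMap.smul_apply, wedgeForms_zero_apply, Subsingleton.elim v 0]
    simp
  rw [this]
  exact Submodule.smul_mem _ _ (Submodule.subset_span ⟨_, fun i => i.elim0, rfl⟩)

/-- A subspace of the dual of a finite-dimensional space contains every linear form that vanishes on
its common kernel. -/
theorem ofSubsingleton_mem_of_kerVec [FiniteDimensional ℝ V]
    {S : Submodule ℝ (V [⋀^Fin 1]→ₗ[ℝ] ℝ)} {φ : V →ₗ[ℝ] ℝ} (h : ∀ X ∈ kerVec S, φ X = 0) :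
    AlternatingMap.ofSubsingleton ℝ V ℝ (0 : Fin 1) φ ∈ S := by
  let e : (V →ₗ[ℝ] ℝ) →ₗ[ℝ] (V [⋀^Fin 1]→ₗ[ℝ] ℝ) :=
    { toFun := AlternatingMap.ofSubsingleton ℝ V ℝ (0 : Fin 1)
      map_add' := fun _ _ => rfl
      map_smul' := fun _ _ => rfl }
  have key : φ ∈ (S.comap e).dualCoannihilator.dualAnnihilator := by
    rw [Submodule.mem_dualAnnihilator]
    intro X hX
    refine h X (mem_kerVec.2 fun σ hσ => ?_)
    rw [Submodule.mem_dualCoannihilator] at hX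
    have := hX ((AlternatingMap.ofSubsingleton ℝ V ℝ (0 : Fin 1)).symm σ) (by
      change AlternatingMap.ofSubsingleton ℝ V ℝ (0 : Fin 1) _ ∈ S
      rwa [Equiv.apply_symm_apply])
    exact this
  rw [Subspace.dualCoannihilator_dualAnnihilator_eq] at key
  exact key

/-- The induction step for `mem_wedgePow_succ_iff`: `β` is recovered, up to the factor `a + 1`, from
its contractions with the vectors of a basis. -/
theorem mem_wedgePow_succ_of_curryLeft [FiniteDimensional ℝ V]
    {S : Submodule ℝ (V [⋀^Fin 1]→ₗ[ℝ] ℝ)} {a : ℕ} {β : V [⋀^Fin (a + 1)]→ₗ[ℝ] ℝ}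
    (h : ∀ X ∈ kerVec S, β.curryLeft X = 0) (h' : ∀ X, β.curryLeft X ∈ wedgePow S a) :
    β ∈ wedgePow S (a + 1) := by
  obtain ⟨C, hC⟩ := (kerVec S).exists_isCompl
  set π : V →ₗ[ℝ] V := C.projection (kerVec S) hC.symm
  have hker : ∀ X, X - π X ∈ kerVec S := fun X => Submodule.sub_projection_mem hC.symm X
  let e := Module.finBasis ℝ V
  -- `(a + 1) β = ∑ (e^j ∘ π) ∧ ι_{e_j} β`, where the forms `e^j ∘ π` vanish on `kerVec S`
  have hexp : ((a : ℝ) + 1) • β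
      = ∑ j, mulLeft (e.coord j ∘ₗ π) (β.curryLeft (e j)) := by
    have h1 : ((a : ℝ) + 1) • β = AlternatingMap.alternatizeUncurryFin β.curryLeft := by
      rw [AlternatingMap.alternatizeUncurryFin_curryLeft]
      ext v
      simp
    have h2 : β.curryLeft = ∑ j, (e.coord j ∘ₗ π).smulRight (β.curryLeft (e j)) := by
      ext X : 1
      have hX : β.curryLeft X = β.curryLeft (π X) := by
        rw [← sub_eq_zero, ← map_sub, h _ (hker X)]
      rw [hX]
      conv_lhs => rw [← e.sum_repr (π X), map_sum]
      simp
    rw [h1]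
    conv_lhs => rw [h2]
    exact map_sum AlternatingMap.alternatizeUncurryFinLM _ _
  have ha : ((a : ℝ) + 1) ≠ 0 := by positivity
  rw [← Submodule.smul_mem_iff _ ha, hexp]
  refine Submodule.sum_mem _ fun j _ => mulLeft_mem_wedgePow ?_ (h' _)
  refine ofSubsingleton_mem_of_kerVec fun X hX => ?_
  have : π X = 0 := (Submodule.projection_apply_eq_zero_iff hC.symm).2 hX
  simp [this]

theorem curryLeft_anticomm {n : ℕ} (β : V [⋀^Fin (n + 2)]→ₗ[ℝ] ℝ) (X Y : V) :
    (β.curryLeft X).curryLeft Y = -(β.curryLeft Y).curryLeft X := by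
  have h := β.curryLeft_same (X + Y)
  simp only [map_add, AlternatingMap.curryLeft_add, LinearMap.add_apply,
    AlternatingMap.curryLeft_same, zero_add, add_zero] at h
  exact eq_neg_of_add_eq_zero_right h

/-- `S^{∧ (a + 1)}` consists of the forms whose contraction with the common kernel of the elements
of `S` vanishes. -/
theorem mem_wedgePow_succ_iff [FiniteDimensional ℝ V]
    {S : Submodule ℝ (V [⋀^Fin 1]→ₗ[ℝ] ℝ)} {a : ℕ} {β : V [⋀^Fin (a + 1)]→ₗ[ℝ] ℝ} :
    β ∈ wedgePow S (a + 1) ↔ ∀ X ∈ kerVec S, β.curryLeft X = 0 := by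
  constructor
  · rintro hβ _ ⟨u, hu, rfl⟩
    have := contract_wedgePow_eq_zero S hβ hu
    rwa [contract_one] at this
  · intro h
    induction a with
    | zero => exact mem_wedgePow_succ_of_curryLeft h fun X => mem_wedgePow_zero S _
    | succ a ih =>
      refine mem_wedgePow_succ_of_curryLeft h fun X => ih fun Y hY => ?_
      rw [curryLeft_anticomm, h Y hY, AlternatingMap.curryLeft_zero, LinearMap.zero_apply, neg_zero]

/-- Products of linear forms span all forms: this is `mem_wedgePow_succ_iff` for `S = ⊤`, where the
common kernel is zero. -/
theorem span_wedgeForms [FiniteDimensional ℝ V] (a : ℕ) :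
    Submodule.span ℝ (Set.range (wedgeForms (V := V) (a := a))) = ⊤ := by
  have : wedgePow (⊤ : Submodule ℝ (V [⋀^Fin 1]→ₗ[ℝ] ℝ)) a = ⊤ := by
    cases a with
    | zero => exact eq_top_iff.2 fun β _ => mem_wedgePow_zero _ β
    | succ a =>
      refine eq_top_iff.2 fun β _ => mem_wedgePow_succ_iff.2 fun X hX => ?_
      have : X = 0 := by
        rw [← Module.forall_dual_apply_eq_zero_iff ℝ X]
        intro φ
        exact mem_kerVec.1 hX (AlternatingMap.ofSubsingleton ℝ V ℝ (0 : Fin 1) φ) trivial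
      rw [this, map_zero]
  rw [← this, wedgePow]
  congr 1
  ext ξ
  simp [eq_comm]

/-- To prove a property that is stable under linear combinations, it is enough to consider products
of linear forms. -/
@[elab_as_elim]
theorem wedgeForms_induction [FiniteDimensional ℝ V] {a : ℕ} {P : (V [⋀^Fin a]→ₗ[ℝ] ℝ) → Prop}
    (α : V [⋀^Fin a]→ₗ[ℝ] ℝ) (forms : ∀ θ, P (wedgeForms θ)) (add : ∀ x y, P x → P y → P (x + y))
    (smul : ∀ (c : ℝ) x, P x → P (c • x)) : P α := by
  have h : α ∈ Submodule.span ℝ (Set.range (wedgeForms (V := V) (a := a))) := by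
    rw [span_wedgeForms]; trivial
  induction h using Submodule.span_induction with
  | mem x hx => obtain ⟨θ, rfl⟩ := hx; exact forms θ
  | zero => simpa using smul 0 _ (forms 0)
  | add x y _ _ hx hy => exact add x y hx hy
  | smul c x _ hx => exact smul c x hx

/-! ### The exterior product -/

theorem wedge_add_left {a b c : ℕ} (h : a + b = c) (α α' : V [⋀^Fin a]→ₗ[ℝ] ℝ)
    (β : V [⋀^Fin b]→ₗ[ℝ] ℝ) : wedge h (α + α') β = wedge h α β + wedge h α' β := by
  ext v
  simp [wedge, ← AlternatingMap.domCoprod'_apply, TensorProduct.add_tmul]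

theorem wedge_add_right {a b c : ℕ} (h : a + b = c) (α : V [⋀^Fin a]→ₗ[ℝ] ℝ)
    (β β' : V [⋀^Fin b]→ₗ[ℝ] ℝ) : wedge h α (β + β') = wedge h α β + wedge h α β' := by
  ext v
  simp [wedge, ← AlternatingMap.domCoprod'_apply, TensorProduct.tmul_add]

theorem wedge_smul_left {a b c : ℕ} (h : a + b = c) (t : ℝ) (α : V [⋀^Fin a]→ₗ[ℝ] ℝ)
    (β : V [⋀^Fin b]→ₗ[ℝ] ℝ) : wedge h (t • α) β = t • wedge h α β := by
  ext v
  simp [wedge, ← AlternatingMap.domCoprod'_apply, ← TensorProduct.smul_tmul']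

theorem wedge_smul_right {a b c : ℕ} (h : a + b = c) (t : ℝ) (α : V [⋀^Fin a]→ₗ[ℝ] ℝ)
    (β : V [⋀^Fin b]→ₗ[ℝ] ℝ) : wedge h α (t • β) = t • wedge h α β := by
  ext v
  simp [wedge, ← AlternatingMap.domCoprod'_apply]

/-- The exterior product as a bilinear map. -/
def wedgeLM {a b c : ℕ} (h : a + b = c) :
    (V [⋀^Fin a]→ₗ[ℝ] ℝ) →ₗ[ℝ] (V [⋀^Fin b]→ₗ[ℝ] ℝ) →ₗ[ℝ] (V [⋀^Fin c]→ₗ[ℝ] ℝ) :=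
  LinearMap.mk₂ ℝ (wedge h) (wedge_add_left h) (wedge_smul_left h) (wedge_add_right h)
    (wedge_smul_right h)

@[simp]
theorem wedgeLM_apply {a b c : ℕ} (h : a + b = c) (α : V [⋀^Fin a]→ₗ[ℝ] ℝ)
    (β : V [⋀^Fin b]→ₗ[ℝ] ℝ) : wedgeLM h α β = wedge h α β := rfl

theorem zero_wedge {a b c : ℕ} (h : a + b = c) (β : V [⋀^Fin b]→ₗ[ℝ] ℝ) :
    wedge h (0 : V [⋀^Fin a]→ₗ[ℝ] ℝ) β = 0 := LinearMap.map_zero₂ (wedgeLM h) β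

theorem wedge_zero {a b c : ℕ} (h : a + b = c) (α : V [⋀^Fin a]→ₗ[ℝ] ℝ) :
    wedge h α (0 : V [⋀^Fin b]→ₗ[ℝ] ℝ) = 0 := map_zero (wedgeLM h α)

theorem neg_wedge {a b c : ℕ} (h : a + b = c) (α : V [⋀^Fin a]→ₗ[ℝ] ℝ)
    (β : V [⋀^Fin b]→ₗ[ℝ] ℝ) : wedge h (-α) β = -wedge h α β :=
  (wedgeLM h).map_neg₂ α β

theorem wedge_neg {a b c : ℕ} (h : a + b = c) (α : V [⋀^Fin a]→ₗ[ℝ] ℝ)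
    (β : V [⋀^Fin b]→ₗ[ℝ] ℝ) : wedge h α (-β) = -wedge h α β :=
  (wedgeLM h α).map_neg β

/-- The Leibniz formula for the determinant: `θ₁ ∧ ⋯ ∧ θ_a` is the alternatization of the product of
the linear forms. Exterior products of such alternatizations are known to Mathlib. -/
theorem wedgeForms_eq_alternatization {a : ℕ} (θ : Fin a → (V →ₗ[ℝ] ℝ)) :
    wedgeForms θ = MultilinearMap.alternatization
      ((MultilinearMap.mkPiAlgebra ℝ (Fin a) ℝ).compLinearMap θ) := by
  ext v
  rw [MultilinearMap.alternatization_apply]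
  change Matrix.det (Matrix.of fun i j => θ j (v i)) = _
  rw [Matrix.det_apply]
  rfl

theorem wedge_wedgeForms {a b c : ℕ} (h : a + b = c) (θ : Fin a → (V →ₗ[ℝ] ℝ))
    (ψ : Fin b → (V →ₗ[ℝ] ℝ)) :
    wedge h (wedgeForms θ) (wedgeForms ψ)
      = wedgeForms fun i => Fin.append θ ψ (Fin.cast h.symm i) := by
  subst h
  simp only [wedgeForms_eq_alternatization, wedge, ← MultilinearMap.domCoprod_alternization,
    ← LinearMap.compMultilinearMap_alternatization]
  ext v
  rw [AlternatingMap.domDomCongr_apply, MultilinearMap.alternatization_apply,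
    MultilinearMap.alternatization_apply]
  refine Fintype.sum_equiv (finSumFinEquiv.permCongr) _ _ fun σ => ?_
  rw [Equiv.Perm.sign_permCongr]
  congr 1
  simp [Fin.prod_univ_add]

/-- `(φ ∧ α) ∧ β = φ ∧ (α ∧ β)`. -/
theorem wedge_mulLeft [FiniteDimensional ℝ V] {a b c : ℕ} (h : a + b = c) (h' : a + 1 + b = c + 1)
    (φ : V →ₗ[ℝ] ℝ) (α : V [⋀^Fin a]→ₗ[ℝ] ℝ) (β : V [⋀^Fin b]→ₗ[ℝ] ℝ) :
    wedge h' (mulLeft φ α) β = mulLeft φ (wedge h α β) := by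
  subst h
  induction α using wedgeForms_induction with
  | add x y hx hy => simp only [map_add, wedge_add_left, hx, hy]
  | smul c x hx => simp only [map_smul, wedge_smul_left, hx]
  | forms θ =>
    induction β using wedgeForms_induction with
    | add x y hx hy => simp only [map_add, wedge_add_right, hx, hy]
    | smul c x hx => simp only [map_smul, wedge_smul_right, hx]
    | forms ψ =>
      rw [← wedgeForms_cons, wedge_wedgeForms, wedge_wedgeForms, ← wedgeForms_cons]
      congr 1
      ext i : 1
      rw [Fin.append_cons]
      rfl

theorem wedge_zero_left [FiniteDimensional ℝ V] {b : ℕ} (h : 0 + b = b) (α : V [⋀^Fin 0]→ₗ[ℝ] ℝ)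
    (β : V [⋀^Fin b]→ₗ[ℝ] ℝ) : wedge h α β = α 0 • β := by
  induction α using wedgeForms_induction with
  | add x y hx hy => simp only [wedge_add_left, hx, hy, AlternatingMap.add_apply, add_smul]
  | smul c x hx => simp only [wedge_smul_left, hx, AlternatingMap.smul_apply, smul_assoc]
  | forms θ =>
    induction β using wedgeForms_induction with
    | add x y hx hy => rw [wedge_add_right, hx, hy, smul_add]
    | smul c x hx => rw [wedge_smul_right, hx, smul_comm]
    | forms ψ =>
      rw [wedge_wedgeForms, wedgeForms_zero_apply, one_smul]
      congr 1
      ext i : 1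
      rw [Fin.append_left_nil θ ψ rfl]
      rfl

/-- To prove a property of forms of positive degree that is stable under linear combinations, it is
enough to consider products `φ ∧ γ` with a linear form `φ`. -/
theorem mulLeft_induction [FiniteDimensional ℝ V] {a : ℕ} {P : (V [⋀^Fin (a + 1)]→ₗ[ℝ] ℝ) → Prop}
    (α : V [⋀^Fin (a + 1)]→ₗ[ℝ] ℝ) (mul : ∀ φ γ, P (mulLeft φ γ))
    (add : ∀ x y, P x → P y → P (x + y)) (smul : ∀ (c : ℝ) x, P x → P (c • x)) : P α := by
  induction α using wedgeForms_induction with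
  | add x y hx hy => exact add x y hx hy
  | smul c x hx => exact smul c x hx
  | forms θ =>
    rw [← Fin.cons_self_tail θ, wedgeForms_cons]
    exact mul _ _

/-- Contraction with a vector is an antiderivation of the exterior product. -/
theorem curryLeft_wedge [FiniteDimensional ℝ V] {a b c : ℕ} (h : a + 1 + (b + 1) = c + 1)
    (h₁ : a + (b + 1) = c) (h₂ : a + 1 + b = c) (α : V [⋀^Fin (a + 1)]→ₗ[ℝ] ℝ)
    (β : V [⋀^Fin (b + 1)]→ₗ[ℝ] ℝ) (X : V) :
    (wedge h α β).curryLeft X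
      = wedge h₁ (α.curryLeft X) β + (-1 : ℝ) ^ (a + 1) • wedge h₂ α (β.curryLeft X) := by
  induction a generalizing c with
  | zero =>
    obtain rfl : c = b + 1 := by omega
    induction α using mulLeft_induction with
    | add x y hx hy =>
      simp only [wedge_add_left, AlternatingMap.curryLeft_add, LinearMap.add_apply, hx, hy, smul_add]
      abel
    | smul c x hx =>
      simp only [wedge_smul_left, AlternatingMap.curryLeft_smul, LinearMap.smul_apply, hx, smul_add]
      rw [smul_comm]
    | mul φ γ =>
      rw [wedge_mulLeft h₁, wedge_mulLeft (Nat.zero_add b), wedge_zero_left, wedge_zero_left,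
        curryLeft_mulLeft_succ, curryLeft_mulLeft_zero, wedge_zero_left,
        AlternatingMap.curryLeft_smul, LinearMap.smul_apply, AlternatingMap.smul_apply, smul_eq_mul,
        map_smul]
      module
  | succ a ih =>
    obtain ⟨c, rfl⟩ : ∃ d, c = d + 1 := ⟨a + b + 1, by omega⟩
    induction α using mulLeft_induction with
    | add x y hx hy =>
      simp only [wedge_add_left, AlternatingMap.curryLeft_add, LinearMap.add_apply, hx, hy, smul_add]
      abel
    | smul c x hx =>
      simp only [wedge_smul_left, AlternatingMap.curryLeft_smul, LinearMap.smul_apply, hx, smul_add]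
      rw [smul_comm]
    | mul φ γ =>
      rw [wedge_mulLeft h₁, wedge_mulLeft (by omega : a + 1 + b = c), curryLeft_mulLeft_succ,
        curryLeft_mulLeft_succ, ih h₁ (by omega) (by omega), map_add, map_smul,
        sub_eq_add_neg (φ X • γ), wedge_add_left,
        wedge_smul_left, ← neg_one_smul ℝ (mulLeft φ (γ.curryLeft X)), wedge_smul_left,
        wedge_mulLeft (by omega : a + (b + 1) = c)]
      rw [pow_succ _ (a + 1)]
      module

theorem wedge_mem_wedgePow [FiniteDimensional ℝ V] {S : Submodule ℝ (V [⋀^Fin 1]→ₗ[ℝ] ℝ)}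
    {a b c : ℕ} (h : a + 1 + (b + 1) = c + 1) {α : V [⋀^Fin (a + 1)]→ₗ[ℝ] ℝ}
    {β : V [⋀^Fin (b + 1)]→ₗ[ℝ] ℝ} (hα : α ∈ wedgePow S (a + 1)) (hβ : β ∈ wedgePow S (b + 1)) :
    wedge h α β ∈ wedgePow S (c + 1) := by
  rw [mem_wedgePow_succ_iff] at *
  intro X hX
  rw [curryLeft_wedge h (by omega) (by omega), hα X hX, hβ X hX, zero_wedge, wedge_zero, smul_zero,
    add_zero]

theorem wedge_compLinearMap [FiniteDimensional ℝ V] {a b c : ℕ} (h : a + b = c)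
    (α : V [⋀^Fin a]→ₗ[ℝ] ℝ) (β : V [⋀^Fin b]→ₗ[ℝ] ℝ) (f : W →ₗ[ℝ] V) :
    (wedge h α β).compLinearMap f = wedge h (α.compLinearMap f) (β.compLinearMap f) := by
  induction α using wedgeForms_induction with
  | add x y hx hy => simp only [wedge_add_left, AlternatingMap.add_compLinearMap, hx, hy]
  | smul t x hx =>
    rw [wedge_smul_left]
    change t • (wedge h x β).compLinearMap f = wedge h (t • x.compLinearMap f) _
    rw [hx, wedge_smul_left]
  | forms θ =>
    induction β using wedgeForms_induction with
    | add x y hx hy => simp only [wedge_add_right, AlternatingMap.add_compLinearMap, hx, hy]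
    | smul t x hx =>
      rw [wedge_smul_right]
      change t • (wedge h (wedgeForms θ) x).compLinearMap f = wedge h _ (t • x.compLinearMap f)
      rw [hx, wedge_smul_right]
    | forms ψ =>
      rw [wedge_wedgeForms, wedgeForms_comp, wedgeForms_comp, wedgeForms_comp, wedge_wedgeForms]
      congr 1
      ext i : 1
      induction Fin.cast h.symm i using Fin.addCases <;> simp

/-! ### Alternatization and the exterior product -/

/-- To prove a property of linear maps that is stable under sums, it is enough to consider maps of rank
at most one. -/
theorem smulRight_induction [FiniteDimensional ℝ V] {N : Type*} [AddCommGroup N] [Module ℝ N]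
    {P : (V →ₗ[ℝ] N) → Prop} (f : V →ₗ[ℝ] N) (smul : ∀ (φ : V →ₗ[ℝ] ℝ) x, P (φ.smulRight x))
    (add : ∀ f g, P f → P g → P (f + g)) : P f := by
  let e := Module.finBasis ℝ V
  have hf : f = ∑ j, (e.coord j).smulRight (f (e j)) := by
    ext X
    conv_lhs => rw [← e.sum_repr X, map_sum]
    simp
  rw [hf]
  refine Finset.sum_induction _ P add ?_ fun j _ => smul _ _
  simpa using smul 0 0

theorem alternatizeUncurryFin_wedge_left [FiniteDimensional ℝ V] {a b c : ℕ} (h : a + b = c)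
    (h' : a + 1 + b = c + 1) (f : V →ₗ[ℝ] V [⋀^Fin a]→ₗ[ℝ] ℝ) (β : V [⋀^Fin b]→ₗ[ℝ] ℝ) :
    AlternatingMap.alternatizeUncurryFin ((wedgeLM h).flip β ∘ₗ f)
      = wedge h' (AlternatingMap.alternatizeUncurryFin f) β := by
  induction f using smulRight_induction with
  | add f g hf hg =>
    rw [LinearMap.comp_add, AlternatingMap.alternatizeUncurryFin_add, hf, hg,
      AlternatingMap.alternatizeUncurryFin_add, wedge_add_left]
  | smul φ α =>
    rw [← mulLeft_apply, wedge_mulLeft h, mulLeft_apply]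
    congr 1
    ext X : 1
    simp

/-- `φ ∧ (α ∧ β) = (-1)ᵃ α ∧ (φ ∧ β)`. -/
theorem wedge_mulLeft_right [FiniteDimensional ℝ V] {a b c : ℕ} (h : a + b = c)
    (h' : a + (b + 1) = c + 1) (φ : V →ₗ[ℝ] ℝ) (α : V [⋀^Fin a]→ₗ[ℝ] ℝ) (β : V [⋀^Fin b]→ₗ[ℝ] ℝ) :
    mulLeft φ (wedge h α β) = (-1 : ℝ) ^ a • wedge h' α (mulLeft φ β) := by
  induction a generalizing c with
  | zero =>
    obtain rfl : c = b := by omega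
    simp [wedge_zero_left]
  | succ a ih =>
    obtain ⟨c, rfl⟩ : ∃ d, c = d + 1 := ⟨a + b, by omega⟩
    induction α using mulLeft_induction with
    | add x y hx hy => simp only [wedge_add_left, map_add, hx, hy, smul_add]
    | smul t x hx =>
      simp only [wedge_smul_left, map_smul, hx]
      rw [smul_comm]
    | mul ψ γ =>
      rw [wedge_mulLeft (by omega : a + b = c), wedge_mulLeft (by omega : a + (b + 1) = c + 1),
        mulLeft_anticomm, ih (by omega) (by omega), map_smul, pow_succ]
      module

theorem alternatizeUncurryFin_wedge_right [FiniteDimensional ℝ V] {a b c : ℕ} (h : a + b = c)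
    (h' : a + (b + 1) = c + 1) (f : V →ₗ[ℝ] V [⋀^Fin b]→ₗ[ℝ] ℝ) (α : V [⋀^Fin a]→ₗ[ℝ] ℝ) :
    AlternatingMap.alternatizeUncurryFin (wedgeLM h α ∘ₗ f)
      = (-1 : ℝ) ^ a • wedge h' α (AlternatingMap.alternatizeUncurryFin f) := by
  induction f using smulRight_induction with
  | add f g hf hg =>
    rw [LinearMap.comp_add, AlternatingMap.alternatizeUncurryFin_add, hf, hg,
      AlternatingMap.alternatizeUncurryFin_add, wedge_add_right, smul_add]
  | smul φ β =>
    rw [← mulLeft_apply, ← wedge_mulLeft_right h, mulLeft_apply]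
    congr 1
    ext X : 1
    simp

end Algebra

/-! ### Contractions and Lie derivatives on a vector space -/

section Calculus

open ContinuousAlternatingMap

variable {E : Type*} [NormedAddCommGroup E] [NormedSpace ℝ E]

theorem finiteDimensional_continuousAlternatingMap [FiniteDimensional ℝ E] (a : ℕ) :
    FiniteDimensional ℝ (E [⋀^Fin a]→L[ℝ] ℝ) :=
  FiniteDimensional.of_injective
    (ContinuousAlternatingMap.toAlternatingMapLinear (R := ℝ) (A := ℝ) (M := E) (N := ℝ) (ι := Fin a))
    ContinuousAlternatingMap.toAlternatingMap_injective

theorem isBoundedBilinearMap_curryLeft (a : ℕ) :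
    IsBoundedBilinearMap ℝ fun p : E × (E [⋀^Fin (a + 1)]→L[ℝ] ℝ) => p.2.curryLeft p.1 where
  add_left _ _ _ := _root_.map_add _ _ _
  smul_left _ _ _ := _root_.map_smul _ _ _
  add_right _ _ _ := rfl
  smul_right _ _ _ := rfl
  bound := ⟨1, one_pos, fun X ξ => by
    have h := ξ.curryLeft.le_opNorm X
    rwa [norm_curryLeft, mul_comm, ← one_mul ‖X‖] at h⟩

/-- Contraction with a vector, as a continuous linear map. -/
def iotaCLM (a : ℕ) (X : E) : (E [⋀^Fin (a + 1)]→L[ℝ] ℝ) →L[ℝ] (E [⋀^Fin a]→L[ℝ] ℝ) :=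
  ((isBoundedBilinearMap_curryLeft a).isBoundedLinearMap_right X).toContinuousLinearMap

@[simp]
theorem iotaCLM_apply (a : ℕ) (X : E) (ξ : E [⋀^Fin (a + 1)]→L[ℝ] ℝ) :
    iotaCLM a X ξ = ξ.curryLeft X := rfl

theorem curryLeft_anticomm_continuous {n : ℕ} (β : E [⋀^Fin (n + 2)]→L[ℝ] ℝ) (X Y : E) :
    (β.curryLeft X).curryLeft Y = -(β.curryLeft Y).curryLeft X :=
  toAlternatingMap_injective (curryLeft_anticomm β.toAlternatingMap X Y)

theorem curryLeft_alternatizeUncurryFin_zero_continuous (f : E →L[ℝ] E [⋀^Fin 0]→L[ℝ] ℝ) (X : E) :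
    (alternatizeUncurryFin f).curryLeft X = f X := by
  apply toAlternatingMap_injective
  rw [toAlternatingMap_curryLeft, toAlternatingMap_alternatizeUncurryFin,
    curryLeft_alternatizeUncurryFin_zero]
  rfl

theorem curryLeft_alternatizeUncurryFin_succ_continuous {n : ℕ}
    (f : E →L[ℝ] E [⋀^Fin (n + 1)]→L[ℝ] ℝ) (X : E) :
    (alternatizeUncurryFin f).curryLeft X = f X - alternatizeUncurryFin (iotaCLM n X ∘L f) := by
  apply toAlternatingMap_injective
  rw [toAlternatingMap_curryLeft, toAlternatingMap_alternatizeUncurryFin,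
    curryLeft_alternatizeUncurryFin_succ]
  change _ = (f X).toAlternatingMap - (alternatizeUncurryFin (iotaCLM n X ∘L f)).toAlternatingMap
  rw [toAlternatingMap_alternatizeUncurryFin]
  rfl

theorem alternatizeUncurryFin_neg {n : ℕ} (f : E →L[ℝ] E [⋀^Fin n]→L[ℝ] ℝ) :
    alternatizeUncurryFin (-f) = -alternatizeUncurryFin f := by
  ext v
  simp [alternatizeUncurryFin_apply]

theorem alternatizeUncurryFin_zero {n : ℕ} :
    alternatizeUncurryFin (0 : E →L[ℝ] E [⋀^Fin n]→L[ℝ] ℝ) = 0 := by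
  ext v
  simp [alternatizeUncurryFin_apply]

theorem hasFDerivAt_curryLeft {a : ℕ} {ξ : E → E [⋀^Fin (a + 1)]→L[ℝ] ℝ} {u : E → E} {y : E}
    (hξ : DifferentiableAt ℝ ξ y) (hu : DifferentiableAt ℝ u y) :
    HasFDerivAt (fun z => (ξ z).curryLeft (u z))
      (iotaCLM a (u y) ∘L fderiv ℝ ξ y + (ξ y).curryLeft ∘L fderiv ℝ u y) y := by
  refine (((isBoundedBilinearMap_curryLeft a).hasFDerivAt (u y, ξ y)).comp y
    (hu.hasFDerivAt.prodMk hξ.hasFDerivAt)).congr_fderiv ?_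
  ext1 X
  rfl

theorem contDiffAt_curryLeft {a : ℕ} {n : WithTop ℕ∞} {ξ : E → E [⋀^Fin (a + 1)]→L[ℝ] ℝ}
    {u : E → E} {y : E} (hξ : ContDiffAt ℝ n ξ y) (hu : ContDiffAt ℝ n u y) :
    ContDiffAt ℝ n (fun z => (ξ z).curryLeft (u z)) y := by
  exact (isBoundedBilinearMap_curryLeft a).contDiff.contDiffAt.comp y (hu.prodMk hξ)

theorem contDiffAt_extDeriv {a : ℕ} {ξ : E → E [⋀^Fin a]→L[ℝ] ℝ} {y : E}
    (hξ : ContDiffAt ℝ ∞ ξ y) : ContDiffAt ℝ ∞ (extDeriv ξ) y := by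
  have h1 : ContDiffAt ℝ ∞ (fderiv ℝ ξ) y := hξ.fderiv_right (m := ∞) (by simp)
  have : ContDiffAt ℝ ∞ (fun z => alternatizeUncurryFinCLM ℝ E ℝ (fderiv ℝ ξ z)) y := by fun_prop
  exact this

/-- The Lie derivative along the vector field `u` of the form `ξ` on a vector space, computed
from the derivatives of `ξ` and `u`. -/
def lieFlat {a : ℕ} (u : E → E) (ξ : E → E [⋀^Fin (a + 1)]→L[ℝ] ℝ) (y : E) :
    E [⋀^Fin (a + 1)]→L[ℝ] ℝ :=
  fderiv ℝ ξ y (u y) + alternatizeUncurryFin ((ξ y).curryLeft ∘L fderiv ℝ u y)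

/-- Cartan's formula. -/
theorem extDeriv_curryLeft_add {a : ℕ} {ξ : E → E [⋀^Fin (a + 1)]→L[ℝ] ℝ} {u : E → E} {y : E}
    (hξ : DifferentiableAt ℝ ξ y) (hu : DifferentiableAt ℝ u y) :
    extDeriv (fun z => (ξ z).curryLeft (u z)) y + (extDeriv ξ y).curryLeft (u y)
      = lieFlat u ξ y := by
  rw [extDeriv, (hasFDerivAt_curryLeft hξ hu).fderiv, extDeriv,
    curryLeft_alternatizeUncurryFin_succ_continuous, alternatizeUncurryFin_add, lieFlat]
  abel

theorem curryLeft_extDeriv_zero {ξ : E → E [⋀^Fin 0]→L[ℝ] ℝ} {X y : E} :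
    (extDeriv ξ y).curryLeft X = fderiv ℝ ξ y X :=
  curryLeft_alternatizeUncurryFin_zero_continuous _ _

/-- Contraction of a Lie derivative with a vector in the kernel of the form. -/
theorem curryLeft_lieFlat {a : ℕ} {ξ : E → E [⋀^Fin (a + 1)]→L[ℝ] ℝ} {u : E → E} {y v : E}
    (hv : (ξ y).curryLeft v = 0) :
    (lieFlat u ξ y).curryLeft v
      = (fderiv ℝ ξ y (u y)).curryLeft v + (ξ y).curryLeft (fderiv ℝ u y v) := by
  rw [lieFlat, curryLeft_add, _root_.add_apply]
  congr 1
  cases a with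
  | zero => rw [curryLeft_alternatizeUncurryFin_zero_continuous]; rfl
  | succ a =>
    rw [curryLeft_alternatizeUncurryFin_succ_continuous]
    have : iotaCLM a v ∘L ((ξ y).curryLeft ∘L fderiv ℝ u y) = 0 := by
      ext1 X
      change ((ξ y).curryLeft (fderiv ℝ u y X)).curryLeft v = 0
      rw [curryLeft_anticomm_continuous, hv, curryLeft_zero]
      simp
    rw [this, alternatizeUncurryFin_zero, sub_zero]
    rfl

/-- `ι_{[u, v]} ξ = £_u ι_v ξ - ι_v £_u ξ`, for forms `ξ` of degree at least two. -/
theorem curryLeft_lieBracket_succ {a : ℕ} {ξ : E → E [⋀^Fin (a + 2)]→L[ℝ] ℝ} {u v : E → E} {y : E}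
    (hξ : DifferentiableAt ℝ ξ y) (hv : DifferentiableAt ℝ v y) :
    (ξ y).curryLeft (VectorField.lieBracket ℝ u v y)
      = lieFlat u (fun z => (ξ z).curryLeft (v z)) y - (lieFlat u ξ y).curryLeft (v y) := by
  have hvξ := hasFDerivAt_curryLeft hξ hv
  rw [lieFlat, lieFlat, hvξ.fderiv, curryLeft_add, _root_.add_apply, _root_.add_apply,
    curryLeft_alternatizeUncurryFin_succ_continuous]
  have : iotaCLM a (v y) ∘L ((ξ y).curryLeft ∘L fderiv ℝ u y)
      = -(((ξ y).curryLeft (v y)).curryLeft ∘L fderiv ℝ u y) := by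
    ext1 X
    rw [ContinuousLinearMap.comp_apply, ContinuousLinearMap.comp_apply, iotaCLM_apply,
      curryLeft_anticomm_continuous]
    rfl
  rw [this, alternatizeUncurryFin_neg, VectorField.lieBracket_eq, map_sub]
  simp only [ContinuousLinearMap.comp_apply, iotaCLM_apply]
  module

/-- `ι_{[u, v]} ξ = £_u ι_v ξ - ι_v £_u ξ` for `1`-forms `ξ`, where `£_u` of the function `ι_v ξ` is
`ι_u d ι_v ξ`. -/
theorem curryLeft_lieBracket_zero {ξ : E → E [⋀^Fin 1]→L[ℝ] ℝ} {u v : E → E} {y : E}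
    (hξ : DifferentiableAt ℝ ξ y) (hv : DifferentiableAt ℝ v y) :
    (ξ y).curryLeft (VectorField.lieBracket ℝ u v y)
      = (extDeriv (fun z => (ξ z).curryLeft (v z)) y).curryLeft (u y)
        - (lieFlat u ξ y).curryLeft (v y) := by
  have hvξ := hasFDerivAt_curryLeft hξ hv
  rw [curryLeft_extDeriv_zero, lieFlat, hvξ.fderiv, curryLeft_add, _root_.add_apply, _root_.add_apply,
    curryLeft_alternatizeUncurryFin_zero_continuous, VectorField.lieBracket_eq]
  simp

/-! ### The exterior derivative of an exterior product -/

variable [FiniteDimensional ℝ E]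

/-- `toCont` as a linear map. -/
def toContLM (a : ℕ) : (E [⋀^Fin a]→ₗ[ℝ] ℝ) →ₗ[ℝ] (E [⋀^Fin a]→L[ℝ] ℝ) where
  toFun := toCont
  map_add' _ _ := rfl
  map_smul' _ _ := rfl

/-- The exterior product of continuous alternating maps. -/
def wedgeCont {a b c : ℕ} (h : a + b = c) (α : E [⋀^Fin a]→L[ℝ] ℝ) (β : E [⋀^Fin b]→L[ℝ] ℝ) :
    E [⋀^Fin c]→L[ℝ] ℝ :=
  toCont (wedge h α.toAlternatingMap β.toAlternatingMap)

theorem toAlternatingMap_wedgeCont {a b c : ℕ} (h : a + b = c) (α : E [⋀^Fin a]→L[ℝ] ℝ)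
    (β : E [⋀^Fin b]→L[ℝ] ℝ) :
    (wedgeCont h α β).toAlternatingMap = wedge h α.toAlternatingMap β.toAlternatingMap := rfl

theorem isBoundedBilinearMap_of_finiteDimensional {F G H : Type*} [NormedAddCommGroup F]
    [NormedSpace ℝ F] [FiniteDimensional ℝ F] [NormedAddCommGroup G] [NormedSpace ℝ G]
    [FiniteDimensional ℝ G] [NormedAddCommGroup H] [NormedSpace ℝ H] (B : F →ₗ[ℝ] G →ₗ[ℝ] H) :
    IsBoundedBilinearMap ℝ fun p : F × G => B p.1 p.2 :=
  (LinearMap.toContinuousBilinearMap B).isBoundedBilinearMap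

theorem isBoundedBilinearMap_wedgeCont {a b c : ℕ} (h : a + b = c) :
    IsBoundedBilinearMap ℝ fun p : (E [⋀^Fin a]→L[ℝ] ℝ) × (E [⋀^Fin b]→L[ℝ] ℝ) =>
      wedgeCont h p.1 p.2 := by
  have := finiteDimensional_continuousAlternatingMap (E := E)
  let B : (E [⋀^Fin a]→L[ℝ] ℝ) →ₗ[ℝ] (E [⋀^Fin b]→L[ℝ] ℝ) →ₗ[ℝ] (E [⋀^Fin c]→L[ℝ] ℝ) :=
    ((wedgeLM h).compl₁₂ (toAlternatingMapLinear (R := ℝ)) (toAlternatingMapLinear (R := ℝ))).compr₂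
      (toContLM c)
  exact isBoundedBilinearMap_of_finiteDimensional B

theorem extDeriv_wedgeCont {a b c : ℕ} (h : a + b = c) (h₁ : a + 1 + b = c + 1)
    (h₂ : a + (b + 1) = c + 1) {α : E → E [⋀^Fin a]→L[ℝ] ℝ} {β : E → E [⋀^Fin b]→L[ℝ] ℝ} {y : E}
    (hα : DifferentiableAt ℝ α y) (hβ : DifferentiableAt ℝ β y) :
    extDeriv (fun z => wedgeCont h (α z) (β z)) y
      = wedgeCont h₁ (extDeriv α y) (β y) + (-1 : ℝ) ^ a • wedgeCont h₂ (α y) (extDeriv β y) := by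
  have hB := isBoundedBilinearMap_wedgeCont (E := E) h
  have h2 : HasFDerivAt (fun z => wedgeCont h (α z) (β z))
      ((hB.isBoundedLinearMap_left (β y)).toContinuousLinearMap ∘L fderiv ℝ α y
        + (hB.isBoundedLinearMap_right (α y)).toContinuousLinearMap ∘L fderiv ℝ β y) y := by
    refine ((hB.hasFDerivAt (α y, β y)).comp y
      (hα.hasFDerivAt.prodMk hβ.hasFDerivAt)).congr_fderiv ?_
    ext1 X
    exact add_comm _ _
  rw [extDeriv, h2.fderiv, alternatizeUncurryFin_add]
  congr 1
  · apply toAlternatingMap_injective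
    rw [toAlternatingMap_wedgeCont, extDeriv, toAlternatingMap_alternatizeUncurryFin,
      toAlternatingMap_alternatizeUncurryFin, ← alternatizeUncurryFin_wedge_left h]
    rfl
  · apply toAlternatingMap_injective
    rw [toAlternatingMap_smul, toAlternatingMap_wedgeCont, extDeriv,
      toAlternatingMap_alternatizeUncurryFin, toAlternatingMap_alternatizeUncurryFin,
      ← alternatizeUncurryFin_wedge_right h]
    rfl

omit [FiniteDimensional ℝ E] in
theorem contDiffAt_of_isBoundedBilinearMap {F G H : Type*} [NormedAddCommGroup F]
    [NormedSpace ℝ F] [NormedAddCommGroup G] [NormedSpace ℝ G] [NormedAddCommGroup H]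
    [NormedSpace ℝ H] {B : F → G → H} (hB : IsBoundedBilinearMap ℝ fun p : F × G => B p.1 p.2)
    {n : WithTop ℕ∞} {f : E → F} {g : E → G} {y : E} (hf : ContDiffAt ℝ n f y)
    (hg : ContDiffAt ℝ n g y) : ContDiffAt ℝ n (fun z => B (f z) (g z)) y :=
  hB.contDiff.contDiffAt.comp y (hf.prodMk hg)

theorem contDiffAt_wedgeCont {a b c : ℕ} (h : a + b = c) {n : WithTop ℕ∞}
    {α : E → E [⋀^Fin a]→L[ℝ] ℝ} {β : E → E [⋀^Fin b]→L[ℝ] ℝ} {y : E}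
    (hα : ContDiffAt ℝ n α y) (hβ : ContDiffAt ℝ n β y) :
    ContDiffAt ℝ n (fun z => wedgeCont h (α z) (β z)) y :=
  contDiffAt_of_isBoundedBilinearMap (isBoundedBilinearMap_wedgeCont h) hα hβ

/-! ### Kernels of frames -/

omit [FiniteDimensional ℝ E] in
theorem surjective_pi_of_linearIndependent {r : ℕ} {θ : Fin r → (E →ₗ[ℝ] ℝ)}
    (h : LinearIndependent ℝ θ) : Function.Surjective (LinearMap.pi θ) := by
  rw [← LinearMap.dualMap_injective_iff, injective_iff_map_eq_zero]
  intro φ hφ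
  have : ∑ i, φ (Pi.single i 1) • θ i = 0 := by
    ext X
    have h1 := LinearMap.congr_fun hφ X
    rw [LinearMap.dualMap_apply, LinearMap.pi_apply_eq_sum_univ] at h1
    have hs : ∀ i, (Pi.single i 1 : Fin r → ℝ) = fun j => if i = j then 1 else 0 := fun i => by
      ext j; simp [Pi.single_apply, eq_comm]
    simpa [mul_comm, hs] using h1
  have h0 := Fintype.linearIndependent_iff.1 h _ this
  ext i
  simpa using h0 i

omit [FiniteDimensional ℝ E] in
/-- A vector in the common kernel of pointwise independent `1`-forms at a point extends to a
differentiable section of their kernels. -/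
theorem exists_section_kernel {r : ℕ} {σ : Fin r → E → E [⋀^Fin 1]→L[ℝ] ℝ} {y v : E}
    (hσ : ∀ i, ContDiffAt ℝ 1 (σ i) y) (hli : LinearIndependent ℝ fun i => σ i y)
    (hv : ∀ i, σ i y (fun _ => v) = 0) :
    ∃ V : E → E, DifferentiableAt ℝ V y ∧ V y = v ∧ ∀ᶠ z in 𝓝 y, ∀ i, σ i z (fun _ => V z) = 0 := by
  let e := ContinuousAlternatingMap.ofSubsingletonLIE (𝕜 := ℝ) (E := E) (F := ℝ) (0 : Fin 1)
  let T : E → E →L[ℝ] (Fin r → ℝ) := fun z => ContinuousLinearMap.pi fun i => e.symm (σ i z)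
  have hT : ∀ z X i, T z X i = σ i z (fun _ => X) := fun _ _ _ => rfl
  have hTd : ContDiffAt ℝ 1 T y := by
    have h1 : ContDiffAt ℝ 1 (fun z i => e.symm (σ i z)) y :=
      contDiffAt_pi.2 fun i => e.symm.toContinuousLinearEquiv.contDiff.contDiffAt.comp y (hσ i)
    exact (ContinuousLinearMap.piEquivL ℝ E (fun _ : Fin r => ℝ)).contDiff.contDiffAt.comp y h1
  have hsurj : Function.Surjective (T y).toLinearMap := by
    refine surjective_pi_of_linearIndependent (θ := fun i => (e.symm (σ i y)).toLinearMap) ?_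
    let f : (E [⋀^Fin 1]→L[ℝ] ℝ) →ₗ[ℝ] (E →ₗ[ℝ] ℝ) :=
      ContinuousLinearMap.coeLM ℝ ∘ₗ e.symm.toLinearEquiv.toLinearMap
    refine hli.map' f (LinearMap.ker_eq_bot.2 ?_)
    exact ContinuousLinearMap.coe_injective.comp e.symm.injective
  obtain ⟨B₀, hB₀⟩ := LinearMap.exists_rightInverse_of_surjective _ (LinearMap.range_eq_top.2 hsurj)
  let B : (Fin r → ℝ) →L[ℝ] E := LinearMap.toContinuousLinearMap B₀
  let G : E → (Fin r → ℝ) →L[ℝ] (Fin r → ℝ) := fun z => T z ∘L B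
  have hGd : ContDiffAt ℝ 1 G y := hTd.clm_comp contDiffAt_const
  have hG1 : G y = ((1 : ((Fin r → ℝ) →L[ℝ] (Fin r → ℝ))ˣ) : (Fin r → ℝ) →L[ℝ] (Fin r → ℝ)) := by
    ext1 t
    exact LinearMap.congr_fun hB₀ t
  have hGinv : ContDiffAt ℝ 1 (fun z => Ring.inverse (G z)) y := by
    have h1 := contDiffAt_ringInverse (n := 1) ℝ (1 : ((Fin r → ℝ) →L[ℝ] (Fin r → ℝ))ˣ)
    rw [← hG1] at h1
    exact h1.comp y hGd
  -- projecting `v` to the kernel of `T z` along the range of the right inverse `B` of `T y`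
  refine ⟨fun z => v - B (Ring.inverse (G z) (T z v)), ?_, ?_, ?_⟩
  · have : ContDiffAt ℝ 1 (fun z => v - B (Ring.inverse (G z) (T z v))) y :=
      contDiffAt_const.sub (B.contDiff.contDiffAt.comp y
        (hGinv.clm_apply (hTd.clm_apply contDiffAt_const)))
    exact this.differentiableAt (by simp)
  · have : T y v = 0 := by ext i; exact hv i
    simp [this]
  · have hunit : ∀ᶠ z in 𝓝 y, IsUnit (G z) :=
      hGd.continuousAt.eventually (by rw [hG1]; exact Units.nhds _)
    filter_upwards [hunit] with z hz i
    rw [← hT, map_sub, Pi.sub_apply, sub_eq_zero]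
    have : (G z * Ring.inverse (G z)) (T z v) = T z v := by
      rw [Ring.mul_inverse_cancel _ hz]; rfl
    exact (congrFun this i).symm

omit [FiniteDimensional ℝ E] in
/-- If `ξ` vanishes on the common kernel of the independent `1`-forms `σ i`, and the Lie derivatives
of all `σ i` vanish on a vector `v` of this kernel, then so does the Lie derivative of `ξ`. -/
theorem curryLeft_lieFlat_eq_zero {r a : ℕ} {σ : Fin r → E → E [⋀^Fin 1]→L[ℝ] ℝ}
    {ξ : E → E [⋀^Fin (a + 1)]→L[ℝ] ℝ} {u : E → E} {y v : E}
    (hσ : ∀ i, ContDiffAt ℝ 1 (σ i) y) (hli : LinearIndependent ℝ fun i => σ i y)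
    (hξ : DifferentiableAt ℝ ξ y)
    (hker : ∀ᶠ z in 𝓝 y, ∀ X, (∀ i, σ i z (fun _ => X) = 0) → (ξ z).curryLeft X = 0)
    (hv : ∀ i, σ i y (fun _ => v) = 0) (hlie : ∀ i, lieFlat u (σ i) y (fun _ => v) = 0) :
    (lieFlat u ξ y).curryLeft v = 0 := by
  obtain ⟨V, hV, rfl, hVker⟩ := exists_section_kernel hσ hli hv
  -- the derivative of `ι_V ζ = 0` in the direction of `u`
  have hder : ∀ {b : ℕ} {ζ : E → E [⋀^Fin (b + 1)]→L[ℝ] ℝ}, DifferentiableAt ℝ ζ y →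
      (∀ᶠ z in 𝓝 y, (ζ z).curryLeft (V z) = 0) →
      (fderiv ℝ ζ y (u y)).curryLeft (V y) = -(ζ y).curryLeft (fderiv ℝ V y (u y)) := by
    intro b ζ hζ hz
    have h1 := hasFDerivAt_curryLeft hζ hV
    have h2 : HasFDerivAt (fun z => (ζ z).curryLeft (V z))
        (0 : E →L[ℝ] E [⋀^Fin b]→L[ℝ] ℝ) y :=
      (hasFDerivAt_const (0 : E [⋀^Fin b]→L[ℝ] ℝ) y).congr_of_eventuallyEq hz
    have h3 := DFunLike.congr_fun (h1.unique h2) (u y)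
    exact eq_neg_of_add_eq_zero_left h3
  have hone : ∀ (ζ : E [⋀^Fin 1]→L[ℝ] ℝ) (X : E), ζ (fun _ => X) = 0 ↔ ζ.curryLeft X = 0 := by
    intro ζ X
    have hX : ∀ w : Fin 0 → E, (Matrix.vecCons X w : Fin 1 → E) = fun _ => X := by
      intro w
      ext i
      rw [Subsingleton.elim i 0]; rfl
    constructor
    · intro h
      ext w
      rw [curryLeft_apply_apply, hX, h]; rfl
    · intro h
      have := DFunLike.congr_fun h 0
      rwa [curryLeft_apply_apply, hX] at this
  have hξV : ∀ᶠ z in 𝓝 y, (ξ z).curryLeft (V z) = 0 := by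
    filter_upwards [hker, hVker] with z h1 h2 using h1 _ h2
  rw [curryLeft_lieFlat hξV.self_of_nhds, hder hξ hξV, neg_add_eq_sub, ← map_sub]
  refine hker.self_of_nhds _ fun i => ?_
  have hσV : ∀ᶠ z in 𝓝 y, (σ i z).curryLeft (V z) = 0 := by
    filter_upwards [hVker] with z h2 using (hone _ _).1 (h2 i)
  have := (hone _ _).1 (hlie i)
  rw [curryLeft_lieFlat hσV.self_of_nhds, hder ((hσ i).differentiableAt (by simp)) hσV,
    neg_add_eq_sub, ← map_sub] at this
  exact (hone _ _).2 this

end Calculus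

/-! ### Charts and their differentials -/

section ManifoldCalculus

open ContinuousAlternatingMap (toAlternatingMap_injective)

variable {E : Type*} [NormedAddCommGroup E] [NormedSpace ℝ E]
  {M : Type*} [TopologicalSpace M] [ChartedSpace E M]

section Charts

variable [IsManifold 𝓘(ℝ, E) ∞ M]

theorem chartDeriv_chartSymmDeriv (x₀ : M) {y : E} (hy : y ∈ (chartAt E x₀).target) (X : E) :
    chartDeriv x₀ ((chartAt E x₀).symm y) (chartSymmDeriv x₀ y X) = X :=
  DFunLike.congr_fun ((mdifferentiable_chart (I := 𝓘(ℝ, E)) x₀).comp_symm_deriv hy) X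

theorem chartSymmDeriv_chartDeriv (x₀ : M) {y : E} (hy : y ∈ (chartAt E x₀).target)
    (X : TangentSpace 𝓘(ℝ, E) ((chartAt E x₀).symm y)) :
    chartSymmDeriv x₀ y (chartDeriv x₀ ((chartAt E x₀).symm y) X) = X := by
  have h := (mdifferentiable_chart (I := 𝓘(ℝ, E)) x₀).symm.comp_symm_deriv (x := (chartAt E x₀).symm y)
    ((chartAt E x₀).map_target hy)
  have h' := DFunLike.congr_fun h X
  have hy' : (chartAt E x₀) ((chartAt E x₀).symm y) = y := (chartAt E x₀).right_inv hy
  simp only [OpenPartialHomeomorph.symm_symm] at h'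
  -- `h'` has the differential at `chart (chart.symm y) = y`; its type depends on this point, so that
  -- the point can only be changed after forgetting the types
  have key : ∀ z : E, z = y → ∀ Y : E,
      (mfderiv 𝓘(ℝ, E) 𝓘(ℝ, E) (chartAt E x₀).symm z : E → E) Y
        = (mfderiv 𝓘(ℝ, E) 𝓘(ℝ, E) (chartAt E x₀).symm y : E → E) Y := by
    rintro z rfl Y; rfl
  exact (key _ hy' _).symm.trans h'

theorem chartDeriv_surjective (x₀ : M) {p : M} (hp : p ∈ (chartAt E x₀).source) :
    Function.Surjective (chartDeriv (E := E) x₀ p) := by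
  obtain ⟨y, hy, rfl⟩ : ∃ y ∈ (chartAt E x₀).target, (chartAt E x₀).symm y = p :=
    ⟨_, (chartAt E x₀).map_source hp, (chartAt E x₀).left_inv hp⟩
  exact Function.RightInverse.surjective (chartDeriv_chartSymmDeriv x₀ hy)

omit [NormedSpace ℝ E] [IsManifold 𝓘(ℝ, E) ∞ M] in
theorem tendsto_chart_symm (x : M) :
    Filter.Tendsto (chartAt E x).symm (𝓝 (chartAt E x x)) (𝓝 x) :=
  (chartAt E x).tendsto_symm (mem_chart_source E x)

omit [NormedSpace ℝ E] [IsManifold 𝓘(ℝ, E) ∞ M] in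
theorem eventually_mem_chart_target (x : M) : ∀ᶠ y in 𝓝 (chartAt E x x), y ∈ (chartAt E x).target :=
  (chartAt E x).open_target.mem_nhds (mem_chart_target E x)

/-- The coordinate expression of a vector field in the preferred chart at `x₀`. -/
def vecInChart (x₀ : M) (X : (x : M) → TangentSpace 𝓘(ℝ, E) x) (y : E) : E :=
  chartDeriv x₀ ((chartAt E x₀).symm y) (X ((chartAt E x₀).symm y))

omit [IsManifold 𝓘(ℝ, E) ∞ M] in
theorem vecInChart_self (x : M) (X : (x : M) → TangentSpace 𝓘(ℝ, E) x) :
    vecInChart x X (chartAt E x x) = chartDeriv x x (X x) := by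
  rw [vecInChart, (chartAt E x).left_inv (mem_chart_source E x)]

/-- The vector field `X` is smooth at every point of `U`, in the preferred chart at this point. -/
def SmoothVec (U : Set M) (X : (x : M) → TangentSpace 𝓘(ℝ, E) x) : Prop :=
  ∀ x ∈ U, ContDiffAt ℝ ∞ (vecInChart x X) (chartAt E x x)

/-- Smoothness as a section of the tangent bundle is smoothness of the coordinate expressions, since
the trivialization of the tangent bundle at `x` is the differential of the chart at `x`. -/
theorem SmoothVectorField.smoothVec {U : Set M} (hU : IsOpen U)
    {X : (x : M) → TangentSpace 𝓘(ℝ, E) x} (h : SmoothVectorField U X) : SmoothVec U X := by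
  intro x hx
  have h1 := (Bundle.contMDiffAt_section x).1 ((h x hx).contMDiffAt (hU.mem_nhds hx))
  have h2 : ContMDiffAt 𝓘(ℝ, E) 𝓘(ℝ, E) ∞ (chartAt E x).symm (chartAt E x x) :=
    contMDiffOn_chart_symm.contMDiffAt ((chartAt E x).open_target.mem_nhds (mem_chart_target E x))
  have h3 := (ContMDiffAt.comp_of_eq h1 h2
    ((chartAt E x).left_inv (mem_chart_source E x))).contDiffAt
  refine h3.congr_of_eventuallyEq ?_
  filter_upwards [eventually_mem_chart_target x] with y hy
  have hs := (chartAt E x).map_target hy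
  have h4 := TangentBundle.continuousLinearMapAt_trivializationAt (I := 𝓘(ℝ, E)) hs
  have h5 := DFunLike.congr_fun h4 (X ((chartAt E x).symm y))
  have hb : (chartAt E x).symm y ∈
      (trivializationAt E (TangentSpace 𝓘(ℝ, E)) x).baseSet := by simpa using hs
  rw [Bundle.Trivialization.continuousLinearMapAt_apply_of_mem _ _ hb] at h5
  exact h5.symm

theorem contDiffAt_transition (x₀ z : M) {w : E} (hw : w ∈ (chartAt E z).target)
    (hp : (chartAt E z).symm w ∈ (chartAt E x₀).source) :
    ContDiffAt ℝ ∞ (chartAt E x₀ ∘ (chartAt E z).symm) w := by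
  have h1 : ContMDiffAt 𝓘(ℝ, E) 𝓘(ℝ, E) ∞ (chartAt E z).symm w :=
    contMDiffOn_chart_symm.contMDiffAt ((chartAt E z).open_target.mem_nhds hw)
  have h2 : ContMDiffAt 𝓘(ℝ, E) 𝓘(ℝ, E) ∞ (chartAt E x₀) ((chartAt E z).symm w) :=
    contMDiffOn_chart.contMDiffAt ((chartAt E x₀).open_source.mem_nhds hp)
  exact (h2.comp w h1).contDiffAt

theorem fderiv_transition (x₀ z : M) {p : M} (hp : p ∈ (chartAt E x₀).source)
    (hz : p ∈ (chartAt E z).source) (X : TangentSpace 𝓘(ℝ, E) p) :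
    fderiv ℝ (chartAt E x₀ ∘ (chartAt E z).symm) (chartAt E z p) (chartDeriv z p X)
      = chartDeriv x₀ p X := by
  set τ := chartAt E x₀ ∘ (chartAt E z).symm with hτ
  have h1 : ContMDiffAt 𝓘(ℝ, E) 𝓘(ℝ, E) ∞ τ (chartAt E z p) :=
    (contDiffAt_transition x₀ z ((chartAt E z).map_source hz)
      (by rwa [(chartAt E z).left_inv hz])).contMDiffAt
  have h2 : MDifferentiableAt 𝓘(ℝ, E) 𝓘(ℝ, E) (chartAt E z) p :=
    (mdifferentiable_chart z).mdifferentiableAt hz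
  have h3 := mfderiv_comp p (h1.mdifferentiableAt (by simp)) h2
  have h4 : τ ∘ chartAt E z =ᶠ[𝓝 p] chartAt E x₀ := by
    filter_upwards [(chartAt E z).open_source.mem_nhds hz] with q hq
    simp only [hτ, Function.comp_apply]
    rw [(chartAt E z).left_inv hq]
  rw [h4.mfderiv_eq, mfderiv_eq_fderiv] at h3
  exact (DFunLike.congr_fun h3 X).symm

theorem fderiv_transition_symm (x₀ z : M) {w : E} (hw : w ∈ (chartAt E z).target)
    (hp : (chartAt E z).symm w ∈ (chartAt E x₀).source) (X : E) :
    fderiv ℝ (chartAt E x₀ ∘ (chartAt E z).symm) w X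
      = chartDeriv x₀ ((chartAt E z).symm w) (chartSymmDeriv z w X) := by
  have h := fderiv_transition x₀ z hp ((chartAt E z).map_target hw) (chartSymmDeriv z w X)
  rwa [(chartAt E z).right_inv hw, chartDeriv_chartSymmDeriv z hw] at h

end Charts

end ManifoldCalculus

/-! ### Differential forms on a manifold -/

section FormCalculus

open ContinuousAlternatingMap (toAlternatingMap_injective)

variable {E : Type*} [NormedAddCommGroup E] [NormedSpace ℝ E] [FiniteDimensional ℝ E]
  {M : Type*} [TopologicalSpace M] [ChartedSpace E M]

theorem toAlternatingMap_formInChart {a : ℕ} (x₀ : M) (ξ : FormField E M a) (y : E) :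
    (formInChart x₀ ξ y).toAlternatingMap
      = (ξ ((chartAt E x₀).symm y)).compLinearMap (chartSymmDeriv x₀ y) := rfl

theorem formInChart_congr {a : ℕ} {x : M} {ξ η : FormField E M a} (h : ∀ᶠ z in 𝓝 x, ξ z = η z) :
    formInChart x ξ =ᶠ[𝓝 (chartAt E x x)] formInChart x η := by
  filter_upwards [(tendsto_chart_symm x).eventually h] with y hy
  simp only [formInChart, hy]

theorem extD_congr {a : ℕ} {x : M} {ξ η : FormField E M a} (h : ∀ᶠ z in 𝓝 x, ξ z = η z) :
    extD ξ x = extD η x := by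
  simp only [extD, (formInChart_congr h).extDeriv_eq]

theorem extD_smul {a : ℕ} (c : ℝ) (ξ : FormField E M a) : extD (c • ξ) = c • extD ξ := by
  funext x
  have : formInChart x (c • ξ) = c • formInChart x ξ := rfl
  simp only [extD, this, extDeriv_smul]
  rfl

theorem extD_neg {a : ℕ} (ξ : FormField E M a) : extD (-ξ) = -extD ξ := by
  funext x
  rw [← neg_one_smul ℝ ξ, extD_smul]
  exact neg_one_smul ℝ (extD ξ x)

theorem SmoothForm.congr {a : ℕ} {U : Set M} (hU : IsOpen U) {ξ η : FormField E M a}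
    (hξ : SmoothForm U ξ) (h : ∀ x ∈ U, ξ x = η x) : SmoothForm U η := fun x hx =>
  (hξ x hx).congr_of_eventuallyEq
    (formInChart_congr (Filter.eventually_of_mem (hU.mem_nhds hx) h)).symm

theorem SmoothForm.neg {a : ℕ} {U : Set M} {ξ : FormField E M a} (hξ : SmoothForm U ξ) :
    SmoothForm U (-ξ) := fun x hx => (hξ x hx).neg

variable [IsManifold 𝓘(ℝ, E) ∞ M]

/-- A form is recovered from its coordinate expression in any chart around the point. -/
theorem eq_formInChart {a : ℕ} (x₀ : M) {p : M} (hp : p ∈ (chartAt E x₀).source)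
    (ξ : FormField E M a) :
    ξ p = (formInChart x₀ ξ (chartAt E x₀ p)).toAlternatingMap.compLinearMap (chartDeriv x₀ p) := by
  obtain ⟨y, hy, rfl⟩ : ∃ y ∈ (chartAt E x₀).target, (chartAt E x₀).symm y = p :=
    ⟨_, (chartAt E x₀).map_source hp, (chartAt E x₀).left_inv hp⟩
  rw [(chartAt E x₀).right_inv hy, toAlternatingMap_formInChart]
  ext v
  simp only [AlternatingMap.compLinearMap_apply]
  congr 1
  ext i
  exact (chartSymmDeriv_chartDeriv x₀ hy (v i)).symm

/-- The exterior derivative does not depend on the chart: it commutes with the pullback by a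
transition map. -/
theorem formInChart_extD_apply {a : ℕ} (x₀ : M) {y : E} (hy : y ∈ (chartAt E x₀).target)
    {ξ : FormField E M a} (hξ : DifferentiableAt ℝ (formInChart x₀ ξ) y) :
    formInChart x₀ (extD ξ) y = extDeriv (formInChart x₀ ξ) y := by
  set z : M := (chartAt E x₀).symm y with hz
  have hzs : z ∈ (chartAt E x₀).source := (chartAt E x₀).map_target hy
  have hzz : z ∈ (chartAt E z).source := mem_chart_source E z
  have hy' : chartAt E x₀ z = y := (chartAt E x₀).right_inv hy
  set τ := chartAt E x₀ ∘ (chartAt E z).symm with hτ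
  have hτz : τ (chartAt E z z) = y := by
    rw [hτ, Function.comp_apply, (chartAt E z).left_inv hzz, hy']
  have hτd : ContDiffAt ℝ ∞ τ (chartAt E z z) :=
    contDiffAt_transition x₀ z (mem_chart_target E z) (by rwa [(chartAt E z).left_inv hzz])
  -- the coordinate expression at `z` is the pullback by the transition map of the one at `x₀`
  have hpull : formInChart z ξ =ᶠ[𝓝 (chartAt E z z)]
      fun w => (formInChart x₀ ξ (τ w)).compContinuousLinearMap (fderiv ℝ τ w) := by
    filter_upwards [eventually_mem_chart_target z,
      (tendsto_chart_symm z).eventually ((chartAt E x₀).open_source.mem_nhds hzs)] with w hw hws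
    apply toAlternatingMap_injective
    rw [toAlternatingMap_formInChart, eq_formInChart x₀ hws ξ]
    ext v
    change (formInChart x₀ ξ (τ w)) (fun i => chartDeriv x₀ _ (chartSymmDeriv z w (v i)))
      = (formInChart x₀ ξ (τ w)) (fun i => fderiv ℝ τ w (v i))
    congr 1
    ext i
    exact (fderiv_transition_symm x₀ z hw hws (v i)).symm
  have h1 := hpull.extDeriv_eq
  rw [extDeriv_pullback (by rwa [hτz]) hτd (by simpa using ENat.LEInfty.out), hτz] at h1
  ext v
  change (extD ξ z) (fun i => chartSymmDeriv x₀ y (v i)) = _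
  rw [extD, h1]
  change (extDeriv (formInChart x₀ ξ) y)
    (fun i => fderiv ℝ τ (chartAt E z z) (chartDeriv z z (chartSymmDeriv x₀ y (v i)))) = _
  congr 1
  ext i
  rw [fderiv_transition x₀ z hzs hzz]
  exact chartDeriv_chartSymmDeriv x₀ hy (v i)

theorem formInChart_extD {a : ℕ} {x : M} {ξ : FormField E M a}
    (hξ : ContDiffAt ℝ ∞ (formInChart x ξ) (chartAt E x x)) :
    formInChart x (extD ξ) =ᶠ[𝓝 (chartAt E x x)] extDeriv (formInChart x ξ) := by
  have h1 : ∀ᶠ y in 𝓝 (chartAt E x x), ContDiffAt ℝ 1 (formInChart x ξ) y :=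
    (hξ.of_le (m := 1) (by simp)).eventually (by simp)
  filter_upwards [h1, eventually_mem_chart_target x] with y hy hyt
  exact formInChart_extD_apply x hyt (hy.differentiableAt (by simp))

theorem SmoothForm.extD {a : ℕ} {U : Set M} {ξ : FormField E M a} (hξ : SmoothForm U ξ) :
    SmoothForm U (extD ξ) := fun x hx =>
  (contDiffAt_extDeriv (hξ x hx)).congr_of_eventuallyEq (formInChart_extD (hξ x hx))

theorem extD_extD {a : ℕ} {x : M} {ξ : FormField E M a}
    (hξ : ContDiffAt ℝ ∞ (formInChart x ξ) (chartAt E x x)) : extD (extD ξ) x = 0 := by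
  rw [extD, (formInChart_extD hξ).extDeriv_eq,
    extDeriv_extDeriv_apply hξ (by simpa using ENat.LEInfty.out)]
  rfl

theorem formInChart_iotaVec {a : ℕ} (x₀ : M) {y : E} (hy : y ∈ (chartAt E x₀).target)
    (X : (x : M) → TangentSpace 𝓘(ℝ, E) x) (ξ : FormField E M (a + 1)) :
    formInChart x₀ (iotaVec X ξ) y = (formInChart x₀ ξ y).curryLeft (vecInChart x₀ X y) := by
  apply toAlternatingMap_injective
  rw [ContinuousAlternatingMap.toAlternatingMap_curryLeft, toAlternatingMap_formInChart,
    toAlternatingMap_formInChart, AlternatingMap.curryLeft_compLinearMap, vecInChart,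
    chartSymmDeriv_chartDeriv x₀ hy]
  rfl

theorem formInChart_iotaVec_eventuallyEq {a : ℕ} (x : M)
    (X : (x : M) → TangentSpace 𝓘(ℝ, E) x) (ξ : FormField E M (a + 1)) :
    formInChart x (iotaVec X ξ) =ᶠ[𝓝 (chartAt E x x)]
      fun y => (formInChart x ξ y).curryLeft (vecInChart x X y) := by
  filter_upwards [eventually_mem_chart_target x] with y hy using formInChart_iotaVec x hy X ξ

theorem SmoothForm.iotaVec {a : ℕ} {U : Set M} {ξ : FormField E M (a + 1)} (hξ : SmoothForm U ξ)
    {X : (x : M) → TangentSpace 𝓘(ℝ, E) x} (hX : SmoothVec U X) : SmoothForm U (iotaVec X ξ) :=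
  fun x hx => (contDiffAt_curryLeft (hξ x hx) (hX x hx)).congr_of_eventuallyEq
    (formInChart_iotaVec_eventuallyEq x X ξ)

omit [IsManifold 𝓘(ℝ, E) ∞ M] in
theorem formInChart_wedgeForm {a b c : ℕ} (h : a + b = c) (x : M) (ξ : FormField E M a)
    (η : FormField E M b) :
    formInChart x (wedgeForm h ξ η) = fun y => wedgeCont h (formInChart x ξ y) (formInChart x η y) := by
  funext y
  apply toAlternatingMap_injective
  rw [toAlternatingMap_wedgeCont, toAlternatingMap_formInChart]
  exact wedge_compLinearMap h _ _ _

omit [IsManifold 𝓘(ℝ, E) ∞ M] in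
theorem SmoothForm.wedgeForm {a b c : ℕ} (h : a + b = c) {U : Set M} {ξ : FormField E M a}
    {η : FormField E M b} (hξ : SmoothForm U ξ) (hη : SmoothForm U η) :
    SmoothForm U (wedgeForm h ξ η) := fun x hx => by
  rw [formInChart_wedgeForm]
  exact contDiffAt_wedgeCont h (hξ x hx) (hη x hx)

theorem extD_wedgeForm {a b c : ℕ} (h : a + b = c) (h₁ : a + 1 + b = c + 1)
    (h₂ : a + (b + 1) = c + 1) {x : M} {ξ : FormField E M a} {η : FormField E M b}
    (hξ : ContDiffAt ℝ ∞ (formInChart x ξ) (chartAt E x x))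
    (hη : ContDiffAt ℝ ∞ (formInChart x η) (chartAt E x x)) :
    extD (wedgeForm h ξ η) x = wedge h₁ (extD ξ x) (η x) + (-1 : ℝ) ^ a • wedge h₂ (ξ x) (extD η x) := by
  rw [extD, formInChart_wedgeForm, extDeriv_wedgeCont h h₁ h₂ (hξ.differentiableAt (by simp))
    (hη.differentiableAt (by simp)), eq_formInChart x (mem_chart_source E x) η,
    eq_formInChart x (mem_chart_source E x) ξ, extD, extD, ← wedge_compLinearMap,
    ← wedge_compLinearMap]
  rfl

/-! ### Lie derivatives and brackets -/

/-- Cartan's formula in a chart. -/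
theorem formInChart_lieDVec {a : ℕ} {x : M} {X : (x : M) → TangentSpace 𝓘(ℝ, E) x}
    {ξ : FormField E M (a + 1)} (hξ : ContDiffAt ℝ ∞ (formInChart x ξ) (chartAt E x x))
    (hX : ContDiffAt ℝ ∞ (vecInChart x X) (chartAt E x x)) :
    formInChart x (lieDVec X ξ) (chartAt E x x)
      = lieFlat (vecInChart x X) (formInChart x ξ) (chartAt E x x) := by
  have h1 : ContDiffAt ℝ ∞ (formInChart x (iotaVec X ξ)) (chartAt E x x) :=
    (contDiffAt_curryLeft hξ hX).congr_of_eventuallyEq (formInChart_iotaVec_eventuallyEq x X ξ)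
  have h2 : formInChart x (lieDVec X ξ) (chartAt E x x)
      = formInChart x (extD (iotaVec X ξ)) (chartAt E x x)
        + formInChart x (iotaVec X (extD ξ)) (chartAt E x x) := rfl
  rw [h2, (formInChart_extD h1).self_of_nhds, (formInChart_iotaVec_eventuallyEq x X ξ).extDeriv_eq,
    formInChart_iotaVec x (mem_chart_target E x), (formInChart_extD hξ).self_of_nhds,
    extDeriv_curryLeft_add (hξ.differentiableAt (by simp)) (hX.differentiableAt (by simp))]

/-- Existence of the Lie bracket `b = [X, Y]` at a point, characterized by
`ι_b ξ = £_X ι_Y ξ - ι_Y £_X ξ`; for `1`-forms `ξ`, `£_X ι_Y ξ` is `ι_X d ι_Y ξ`. -/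
theorem exists_bracket {x : M} {X Y : (x : M) → TangentSpace 𝓘(ℝ, E) x}
    (hX : ContDiffAt ℝ ∞ (vecInChart x X) (chartAt E x x))
    (hY : ContDiffAt ℝ ∞ (vecInChart x Y) (chartAt E x x)) :
    ∃ b : TangentSpace 𝓘(ℝ, E) x,
      (∀ (a : ℕ) (ξ : FormField E M (a + 2)),
        ContDiffAt ℝ ∞ (formInChart x ξ) (chartAt E x x) →
          (ξ x).curryLeft b = lieDVec X (iotaVec Y ξ) x - (lieDVec X ξ x).curryLeft (Y x)) ∧
      (∀ ξ : FormField E M 1, ContDiffAt ℝ ∞ (formInChart x ξ) (chartAt E x x) →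
          (ξ x).curryLeft b
            = (extD (iotaVec Y ξ) x).curryLeft (X x) - (lieDVec X ξ x).curryLeft (Y x)) := by
  set y := chartAt E x x with hy
  have hyt : y ∈ (chartAt E x).target := mem_chart_target E x
  obtain ⟨b, hb⟩ := chartDeriv_surjective x (mem_chart_source E x)
    (VectorField.lieBracket ℝ (vecInChart x X) (vecInChart x Y) y)
  have hcurry : ∀ {k : ℕ} (ξ : FormField E M (k + 1)) (Z : TangentSpace 𝓘(ℝ, E) x),
      (ξ x).curryLeft Z = ((formInChart x ξ y).curryLeft
        (chartDeriv x x Z)).toAlternatingMap.compLinearMap (chartDeriv x x) := by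
    intro k ξ Z
    conv_lhs => rw [eq_formInChart x (mem_chart_source E x) ξ, AlternatingMap.curryLeft_compLinearMap]
    rfl
  have hsub : ∀ {k : ℕ} (f g : E [⋀^Fin k]→L[ℝ] ℝ),
      (f - g).toAlternatingMap.compLinearMap (chartDeriv x x)
      = f.toAlternatingMap.compLinearMap (chartDeriv x x)
        - g.toAlternatingMap.compLinearMap (chartDeriv x x) := fun f g => rfl
  have hXd := hX.differentiableAt (by simp)
  have hYd := hY.differentiableAt (by simp)
  refine ⟨b, fun a ξ hξ => ?_, fun ξ hξ => ?_⟩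
  · have hι : ContDiffAt ℝ ∞ (formInChart x (iotaVec Y ξ)) (chartAt E x x) :=
      (contDiffAt_curryLeft hξ hY).congr_of_eventuallyEq (formInChart_iotaVec_eventuallyEq x Y ξ)
    rw [hcurry, hb, curryLeft_lieBracket_succ (hξ.differentiableAt (by simp)) hYd, hcurry,
      eq_formInChart x (mem_chart_source E x) (lieDVec X (iotaVec Y ξ)), formInChart_lieDVec hξ hX,
      formInChart_lieDVec hι hX, hsub, vecInChart_self]
    have hl : lieFlat (vecInChart x X) (formInChart x (iotaVec Y ξ)) y
        = lieFlat (vecInChart x X)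
          (fun z => (formInChart x ξ z).curryLeft (vecInChart x Y z)) y := by
      have h := formInChart_iotaVec_eventuallyEq x Y ξ
      rw [lieFlat, lieFlat, h.fderiv_eq, h.self_of_nhds]
    rw [hl]
  · have hι : ContDiffAt ℝ ∞ (formInChart x (iotaVec Y ξ)) (chartAt E x x) :=
      (contDiffAt_curryLeft hξ hY).congr_of_eventuallyEq (formInChart_iotaVec_eventuallyEq x Y ξ)
    rw [hcurry, hb, curryLeft_lieBracket_zero (hξ.differentiableAt (by simp)) hYd, hcurry, hcurry,
      formInChart_lieDVec hξ hX, (formInChart_extD hι).self_of_nhds, hsub,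
      (formInChart_iotaVec_eventuallyEq x Y ξ).extDeriv_eq, vecInChart_self, vecInChart_self]

/-- If the Lie derivative along `X` preserves the sections of the bundle `S` of `1`-forms spanned by a
frame, and `ξ` vanishes on the common kernel of `S`, then so does the Lie derivative of `ξ`. -/
theorem curryLeft_lieDVec_eq_zero {x : M} {W : Set M} (hW : IsOpen W) (hx : x ∈ W) {r a : ℕ}
    {S : (x : M) → Submodule ℝ ((TangentSpace 𝓘(ℝ, E) x) [⋀^Fin 1]→ₗ[ℝ] ℝ)}
    {σ : Fin r → FormField E M 1} (hσ : ∀ i, SmoothForm W (σ i))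
    (hS : ∀ y ∈ W, LinearIndependent ℝ (fun i => σ i y) ∧
      S y = Submodule.span ℝ (Set.range fun i => σ i y))
    {X : (x : M) → TangentSpace 𝓘(ℝ, E) x} (hX : SmoothVec W X) {ξ : FormField E M (a + 1)}
    (hξ : SmoothForm W ξ) (hker : ∀ y ∈ W, ∀ Y ∈ kerVec (S y), (ξ y).curryLeft Y = 0)
    (hlie : ∀ i, lieDVec X (σ i) x ∈ S x) {v : TangentSpace 𝓘(ℝ, E) x} (hv : v ∈ kerVec (S x)) :
    (lieDVec X ξ x).curryLeft v = 0 := by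
  have hxs := mem_chart_source E x
  have happ : ∀ (η : FormField E M 1) (Z : TangentSpace 𝓘(ℝ, E) x),
      (η x) (fun _ => Z) = formInChart x η (chartAt E x x) (fun _ => chartDeriv x x Z) := by
    intro η Z
    conv_lhs => rw [eq_formInChart x hxs η]
    rfl
  have key : (lieFlat (vecInChart x X) (formInChart x ξ) (chartAt E x x)).curryLeft
      (chartDeriv x x v) = 0 := by
    refine curryLeft_lieFlat_eq_zero (σ := fun i => formInChart x (σ i))
      (fun i => (hσ i x hx).of_le (by simp)) ?_ ((hξ x hx).differentiableAt (by simp)) ?_ ?_ ?_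
    · let f : (E [⋀^Fin 1]→L[ℝ] ℝ) →ₗ[ℝ] ((TangentSpace 𝓘(ℝ, E) x) [⋀^Fin 1]→ₗ[ℝ] ℝ) :=
        { toFun := fun φ => φ.toAlternatingMap.compLinearMap (chartDeriv x x)
          map_add' := fun _ _ => rfl
          map_smul' := fun _ _ => rfl }
      refine LinearIndependent.of_comp f ?_
      convert (hS x hx).1 using 1
      funext i
      exact (eq_formInChart x hxs (σ i)).symm
    · filter_upwards [(tendsto_chart_symm x).eventually (hW.mem_nhds hx)] with y hyW Z hZ
      have hZ' : chartSymmDeriv x y Z ∈ kerVec (S ((chartAt E x).symm y)) := by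
        rw [mem_kerVec, (hS _ hyW).2]
        intro τ hτ
        induction hτ using Submodule.span_induction with
        | mem τ hτ => obtain ⟨i, rfl⟩ := hτ; exact hZ i
        | zero => rfl
        | add τ τ' _ _ h h' => rw [AlternatingMap.add_apply, h, h', add_zero]
        | smul c τ _ h => rw [AlternatingMap.smul_apply, h, smul_zero]
      have h1 := hker _ hyW _ hZ'
      apply toAlternatingMap_injective
      rw [ContinuousAlternatingMap.toAlternatingMap_curryLeft, toAlternatingMap_formInChart,
        AlternatingMap.curryLeft_compLinearMap, h1]
      rfl
    · intro i
      rw [← happ]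
      refine mem_kerVec.1 hv _ ?_
      rw [(hS x hx).2]
      exact Submodule.subset_span ⟨i, rfl⟩
    · intro i
      rw [← formInChart_lieDVec (hσ i x hx) (hX x hx), ← happ]
      exact mem_kerVec.1 hv _ (hlie i)
  rw [eq_formInChart x hxs (lieDVec X ξ), AlternatingMap.curryLeft_compLinearMap,
    formInChart_lieDVec (hξ x hx) (hX x hx), ← ContinuousAlternatingMap.toAlternatingMap_curryLeft, key]
  rfl

/-! ### Vector fields as `1`-vector fields -/

omit [FiniteDimensional ℝ E] [IsManifold 𝓘(ℝ, E) ∞ M] in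
theorem iota_one {k : ℕ} (h : 1 + k = k + 1) (u : MultivectorField E M 1)
    (ξ : FormField E M (k + 1)) : iota h u ξ = iotaVec (fun x => toVec (u x)) ξ := by
  funext x
  exact contract_one h (u x) (ξ x)

omit [IsManifold 𝓘(ℝ, E) ∞ M] in
theorem SmoothMultivector.smoothVec {U : Set M} {u : MultivectorField E M 1}
    (hu : SmoothMultivector U u) : SmoothVec U fun x => toVec (u x) := by
  intro x hx
  let e := Module.finBasis ℝ E
  have h : vecInChart x (fun x => toVec (u x)) = fun y => ∑ j,
      pairing E 1 (multivectorInChart x u y)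
        (AlternatingMap.ofSubsingleton ℝ E ℝ (0 : Fin 1) (e.coord j)) • e j := by
    funext y
    have h1 : vecInChart x (fun x => toVec (u x)) y = toVec (multivectorInChart x u y) := by
      rw [multivectorInChart]
      exact (LinearMap.congr_fun (exteriorPower.oneEquiv_naturality _) _).symm
    rw [h1]
    conv_lhs => rw [← e.sum_repr (toVec (multivectorInChart x u y))]
    simp only [pairing_one]
    rfl
  rw [h]
  exact ContDiffAt.sum fun j _ => (hu x hx _).smul contDiffAt_const

end FormCalculus

/-! ### Pointwise contractions -/

section Pointwise

variable {V : Type*} [AddCommGroup V] [Module ℝ V]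

theorem curryLeft_mem_wedgePow [FiniteDimensional ℝ V] {S : Submodule ℝ (V [⋀^Fin 1]→ₗ[ℝ] ℝ)}
    {a : ℕ} {β : V [⋀^Fin (a + 1)]→ₗ[ℝ] ℝ} (hβ : β ∈ wedgePow S (a + 1)) (X : V) :
    β.curryLeft X ∈ wedgePow S a := by
  cases a with
  | zero => exact mem_wedgePow_zero S _
  | succ a =>
    rw [mem_wedgePow_succ_iff] at hβ ⊢
    intro Y hY
    rw [curryLeft_anticomm, hβ Y hY]
    exact neg_zero

theorem curryLeft_eq_of_sub_mem_kerVec [FiniteDimensional ℝ V]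
    {S : Submodule ℝ (V [⋀^Fin 1]→ₗ[ℝ] ℝ)} {a : ℕ} {β : V [⋀^Fin (a + 1)]→ₗ[ℝ] ℝ}
    (hβ : β ∈ wedgePow S (a + 1)) {X Y : V} (h : X - Y ∈ kerVec S) :
    β.curryLeft X = β.curryLeft Y := by
  have := mem_wedgePow_succ_iff.1 hβ _ h
  rwa [map_sub, sub_eq_zero] at this

theorem eq_zero_of_curryLeft {a : ℕ} {β : V [⋀^Fin (a + 1)]→ₗ[ℝ] ℝ}
    (h : ∀ X, β.curryLeft X = 0) : β = 0 := by
  ext v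
  have := DFunLike.congr_fun (h (v 0)) (Fin.tail v)
  rw [AlternatingMap.curryLeft_apply_apply] at this
  exact (congrArg β (Fin.cons_self_tail v).symm).trans this

theorem sub_neg_one_pow_one_smul {a : ℕ} (β γ : V [⋀^Fin a]→ₗ[ℝ] ℝ) :
    β - (-1 : ℝ) ^ 1 • γ = β + γ := by
  ext v
  simp

end Pointwise

/-! ### The Schouten-Nijenhuis bracket of vector fields -/

section Brackets

variable {E : Type*} [NormedAddCommGroup E] [NormedSpace ℝ E] [FiniteDimensional ℝ E]
  {M : Type*} [TopologicalSpace M] [ChartedSpace E M]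

theorem SmoothForm.mono {a : ℕ} {U W : Set M} {ξ : FormField E M a} (hξ : SmoothForm U ξ)
    (h : W ⊆ U) : SmoothForm W ξ := fun x hx => hξ x (h hx)

omit [FiniteDimensional ℝ E] in
theorem SmoothMultivector.mono {p : ℕ} {U W : Set M} {u : MultivectorField E M p}
    (hu : SmoothMultivector U u) (h : W ⊆ U) : SmoothMultivector W u := fun x hx => hu x (h hx)

theorem SmoothForm.of_locally {a : ℕ} {U : Set M} {ξ : FormField E M a}
    (h : ∀ x ∈ U, ∃ W, IsOpen W ∧ x ∈ W ∧ ∃ η : FormField E M a, SmoothForm W η ∧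
      ∀ y ∈ W, ξ y = η y) : SmoothForm U ξ := by
  intro x hx
  obtain ⟨W, hW, hxW, η, hη, heq⟩ := h x hx
  exact (hη.congr hW fun y hy => (heq y hy).symm) x hxW

variable [IsManifold 𝓘(ℝ, E) ∞ M]

/-- The Schouten-Nijenhuis bracket of two smooth vector fields has the property that characterizes
it: an element as required by its definition exists, since the Lie bracket is one. -/
theorem curryLeft_schouten {u v : MultivectorField E M 1} {x : M} {W₀ : Set M} (hxW₀ : x ∈ W₀)
    (hu : SmoothMultivector W₀ u) (hv : SmoothMultivector W₀ v) {W : Set M} (hW : IsOpen W)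
    (hxW : x ∈ W) {ξ : FormField E M 1} (hξ : SmoothForm W ξ) :
    (ξ x).curryLeft (toVec (schouten le_rfl rfl u v x : ⋀[ℝ]^1 (TangentSpace 𝓘(ℝ, E) x)))
      = (extD (iotaVec (fun x => toVec (v x)) ξ) x).curryLeft (toVec (u x))
        - (lieDVec (fun x => toVec (u x)) ξ x).curryLeft (toVec (v x)) := by
  set X : (x : M) → TangentSpace 𝓘(ℝ, E) x := fun x => toVec (u x) with hX
  set Y : (x : M) → TangentSpace 𝓘(ℝ, E) x := fun x => toVec (v x) with hY
  have hlie : ∀ η : FormField E M 1, lieD 1 rfl u η x = lieDVec X η x := by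
    intro η
    change extD (iota _ u η) x - (-1 : ℝ) ^ 1 • iota _ u (extD η) x = _
    rw [iota_one, iota_one]
    exact sub_neg_one_pow_one_smul _ _
  have hlie₀ : ∀ η : FormField E M 0, lieD 0 rfl u η x = (extD η x).curryLeft (X x) := by
    intro η
    change -((-1 : ℝ) ^ 1 • iota _ u (extD η) x) = _
    rw [iota_one]
    exact (zero_sub _).symm.trans ((sub_neg_one_pow_one_smul 0 _).trans (zero_add _))
  obtain ⟨b, -, hb⟩ := exists_bracket (hu.smoothVec x hxW₀) (hv.smoothVec x hxW₀)
  have hspec := Classical.epsilon_spec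
    (p := fun w : ⋀[ℝ]^1 (TangentSpace 𝓘(ℝ, E) x) =>
      ∀ W : Set M, IsOpen W → x ∈ W → ∀ α : FormField E M 1, SmoothForm W α →
        contract (Nat.add_zero 1) w (α x) =
          (-1 : ℝ) ^ ((1 - 1) * 1) • lieD (b := 1 - 1) 0 (by omega) u
              (iota (by omega : 1 + (1 - 1) = 1) v α) x
            - contract (Nat.add_zero 1) (v x) (lieD 1 rfl u α x))
    ⟨toVec.symm b, fun W' hW' hxW' α hα => by
      have h1 := hb α (hα x hxW')
      have h2 : contract (Nat.add_zero 1) (toVec.symm b) (α x) = (α x).curryLeft b := by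
        refine (contract_one _ _ _).trans ?_
        rw [LinearEquiv.apply_symm_apply]
      rw [h2, h1, hlie]
      simp only [Nat.sub_self, zero_mul, pow_zero, one_smul]
      refine congrArg₂ _ ?_ (contract_one _ _ _).symm
      refine Eq.trans ?_ (hlie₀ (iota (by omega : 1 + 0 = 1) v α)).symm
      rw [show iota (by omega : 1 + 0 = 1) v α = iotaVec Y α from iota_one _ v α]⟩
  have h := hspec W hW hxW ξ hξ
  refine (contract_one (Nat.add_zero 1) _ (ξ x)).symm.trans (h.trans ?_)
  rw [hlie]
  simp only [Nat.sub_self, zero_mul, pow_zero, one_smul]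
  refine congrArg₂ _ ?_ (contract_one _ _ _)
  refine (hlie₀ (iota (by omega : 1 + 0 = 1) v ξ)).trans ?_
  rw [show iota (by omega : 1 + 0 = 1) v ξ = iotaVec Y ξ from iota_one _ v ξ]

/-! ### Hamiltonian vector fields and integrability -/

namespace RegularGradedDirac

variable {m : ℕ} (D : RegularGradedDirac E M (m + 1)) {U : Set M}

omit [IsManifold 𝓘(ℝ, E) ∞ M] in
theorem IsHamiltonian.mono {D : RegularGradedDirac E M (m + 1)} {W : Set M} {a : ℕ}
    {α : FormField E M a} (hα : D.IsHamiltonian U α) (h : W ⊆ U) : D.IsHamiltonian W α :=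
  ⟨hα.1.mono h, fun x hx => hα.2 x (h hx)⟩

omit [IsManifold 𝓘(ℝ, E) ∞ M] in
open Classical in
/-- A Hamiltonian vector field of `α`: a representative, not necessarily smooth, of the class
`♯_n(dα)` at each point (and zero where `dα` is not in `Sⁿ`). -/
def hamVec (α : FormField E M m) (x : M) : TangentSpace 𝓘(ℝ, E) x :=
  if h : extD α x ∈ D.S (m + 1) x then
    toVec (Quotient.out (D.sharp (p := 1) (Nat.le_add_left 1 m) le_rfl rfl x ⟨extD α x, h⟩))
  else 0

omit [IsManifold 𝓘(ℝ, E) ∞ M] in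
theorem poissonTop_eq {a : ℕ} (Θ : FormField E M a) (α : FormField E M m) :
    D.poissonTop Θ α = iotaVec (D.hamVec α) (extD Θ) := by
  funext x
  simp only [poisson, hamVec, iotaVec]
  have hd : degH (m + 1) m = 0 := by simp [degH]
  split_ifs with h
  · rw [hd, zpow_zero, one_smul]
    exact contract_one _ _ _
  · rw [map_zero]

omit [IsManifold 𝓘(ℝ, E) ∞ M] in
/-- On Hamiltonian forms the extended bracket is `-ι_X dΘ`, where `X` is a Hamiltonian vector field
of `α`. -/
theorem extBracket_apply {a : ℕ} {α : FormField E M m} {Θ : FormField E M a} {x : M}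
    (hα : extD α x ∈ D.S (m + 1) x) (hΘ : extD Θ x ∈ wedgePow (D.S 1 x) (a + 1)) :
    D.extBracket α Θ x = -(extD Θ x).curryLeft (D.hamVec α x) := by
  have h1 : D.contractSharp (Nat.le_add_left 1 m) a x ⟨extD Θ x, hΘ⟩ ⟨extD α x, hα⟩
      = (extD Θ x).curryLeft (D.hamVec α x) := by
    have h2 : D.contractSharp (Nat.le_add_left 1 m) a x ⟨extD Θ x, hΘ⟩ ⟨extD α x, hα⟩
      = contractQuot (D.S 1 x) ⟨extD Θ x, hΘ⟩
        (D.sharp (p := 1) (Nat.le_add_left 1 m) le_rfl rfl x ⟨extD α x, hα⟩) := rfl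
    rw [h2, ← Quotient.out_eq (D.sharp (p := 1) (Nat.le_add_left 1 m) le_rfl rfl x ⟨extD α x, hα⟩),
      hamVec, dif_pos hα]
    exact contract_one _ _ _
  have h3 : (-1 : ℝ) ^ degH (m + 1) a
      = -(-1 : ℝ) ^ (((m + 1 : ℕ) : ℤ) + 1 - ((a : ℤ) + 1)) := by
    rw [degH, show ((m + 1 : ℕ) : ℤ) + 1 - ((a : ℤ) + 1) = (((m + 1 : ℕ) : ℤ) - 1 - a) + 1 by ring,
      zpow_add_one₀ (by norm_num)]
    ring
  rw [extBracket, dif_pos ⟨hα, hΘ⟩, h3, ← h1, contractSharp_eq]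
  exact neg_smul (_ : ℝ) (_ : (TangentSpace 𝓘(ℝ, E) x) [⋀^Fin a]→ₗ[ℝ] ℝ)

omit [IsManifold 𝓘(ℝ, E) ∞ M] in
theorem sub_hamVec_mem_kerVec {α : FormField E M m} {x : M} (hα : extD α x ∈ D.S (m + 1) x)
    {u : ⋀[ℝ]^1 (TangentSpace 𝓘(ℝ, E) x)}
    (hu : D.sharp (p := 1) (Nat.le_add_left 1 m) le_rfl rfl x ⟨extD α x, hα⟩
      = Submodule.Quotient.mk u) :
    toVec u - D.hamVec α x ∈ kerVec (D.S 1 x) := by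
  rw [hamVec, dif_pos hα, ← quotient_mk_eq_iff_kerVec, ← hu]
  exact (Quotient.out_eq _).symm

/-- Near each point, the class `♯_n(dα)` of a Hamiltonian form has a smooth representative. -/
theorem IsHamiltonian.exists_smooth_rep {D : RegularGradedDirac E M (m + 1)} (hU : IsOpen U)
    {α : FormField E M m} (hα : D.IsHamiltonian U α) {x : M} (hx : x ∈ U) :
    ∃ W : Set M, IsOpen W ∧ x ∈ W ∧ ∃ hWU : W ⊆ U, ∃ u : MultivectorField E M 1,
      SmoothMultivector W u ∧ ∀ y (hy : y ∈ W),
        D.sharp (p := 1) (Nat.le_add_left 1 m) le_rfl rfl y ⟨extD α y, hα.2 y (hWU hy)⟩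
          = Submodule.Quotient.mk (u y) :=
  D.sharp_smooth _ _ _ U hU (extD α) hα.1.extD hα.2 x hx

/-- For a closed section `dα` of `Sⁿ` with Hamiltonian vector field `X = ♯_n(dα)`, skew-symmetry
reduces the form `θ` of the integrability condition to `£_X β`. In particular `£_X` preserves the
sections of `S^{k+1}`. -/
theorem lieDVec_mem {k q : ℕ} (hq : 1 ≤ q) (hqk : q + k = m + 1) {W : Set M} (hW : IsOpen W)
    {α : FormField E M m} (hα : D.IsHamiltonian W α) {β : FormField E M (k + 1)}
    (hβs : SmoothForm W β) (hβ : ∀ x ∈ W, β x ∈ D.S (k + 1) x)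
    {u : MultivectorField E M 1} {v : MultivectorField E M q}
    (hus : SmoothMultivector W u) (hvs : SmoothMultivector W v)
    (hu : ∀ x (hx : x ∈ W), D.sharp (p := 1) (Nat.le_add_left 1 m) le_rfl rfl x
      ⟨extD α x, hα.2 x hx⟩ = Submodule.Quotient.mk (u x))
    (hv : ∀ x (hx : x ∈ W), D.sharp (p := q) (Nat.le_add_left 1 k) hq (by omega) x
      ⟨β x, hβ x hx⟩ = Submodule.Quotient.mk (v x)) :
    ∀ x ∈ W, ∃ h : lieDVec (fun x => toVec (u x)) β x ∈ D.S (k + 1) x,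
      D.sharp (p := q) (Nat.le_add_left 1 k) hq (by omega) x ⟨_, h⟩
        = Submodule.Quotient.mk (schouten le_rfl (Nat.add_comm 1 q) u v x) := by
  intro x hx
  have hskew : ∀ y ∈ W, iota hqk v (extD α) y
      = ((-1 : ℝ) ^ q • iota (Nat.add_comm 1 k) u β) y := by
    intro y hy
    have := D.skew (Nat.le_add_left 1 m) (Nat.le_add_left 1 k) le_rfl hq rfl (by omega)
      (Nat.add_comm 1 k) hqk y ⟨extD α y, hα.2 y hy⟩ ⟨β y, hβ y hy⟩ (u y) (v y) (hu y hy) (hv y hy)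
    simp only [Pi.smul_apply, iota]
    rw [this, smul_smul, one_mul, ← mul_pow]
    simp
  obtain ⟨h, hs⟩ := D.integrable (Nat.le_add_left 1 m) (Nat.le_add_left 1 k) le_rfl hq rfl
    (by omega) (Nat.add_comm 1 k) hqk (Nat.add_comm 1 q) W hW (extD α) β u v hα.1.extD hβs hus hvs
    hα.2 hβ hu hv _ rfl x hx
  have hev := Filter.eventually_of_mem (hW.mem_nhds hx) hskew
  set A := extD (iota (Nat.add_comm 1 k) u β) with hA
  have h1 : extD (iota hqk v (extD α)) x = (-1 : ℝ) ^ q • A x := by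
    rw [extD_congr hev, extD_smul]
    rfl
  have h2 : extD (iota hqk v (extD α) + (-1 : ℝ) ^ (1 * q) • iota (Nat.add_comm 1 k) u β) x
      = (2 * (-1 : ℝ) ^ q) • A x := by
    have h3 : ∀ᶠ y in 𝓝 x, (iota hqk v (extD α) + (-1 : ℝ) ^ (1 * q) •
        iota (Nat.add_comm 1 k) u β) y
        = ((2 * (-1 : ℝ) ^ q) • iota (Nat.add_comm 1 k) u β) y := by
      filter_upwards [hev] with y hy
      rw [Pi.add_apply, hy, one_mul, two_mul, add_smul]
      rfl
    rw [extD_congr h3, extD_smul]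
    rfl
  have h4 : lieD (k + 1) (by omega : 1 + (k + 1) = (k + 1) + 1) u β x
      = lieDVec (fun x => toVec (u x)) β x := by
    change extD (iota _ u β) x - (-1 : ℝ) ^ 1 • iota _ u (extD β) x = _
    rw [iota_one, iota_one]
    exact sub_neg_one_pow_one_smul _ _
  have h5 : lieD (k + 1) (by omega : q + (k + 1) = (m + 1) + 1) v (extD α) x
      = (-1 : ℝ) ^ q • A x := by
    change extD (iota _ v (extD α)) x - (-1 : ℝ) ^ q • contract _ (v x) (extD (extD α) x) = _
    rw [h1, extD_extD (hα.1 x hx), map_zero, smul_zero, sub_zero]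
  -- the terms `d ι_X β` of `θ - £_X β` cancel: `(-1)^q (-1)^q - (-1)^q / 2 * 2 (-1)^q = 0`
  have hθ : ∀ (θ : FormField E M (k + 1)),
      θ = (-1 : ℝ) ^ ((1 - 1) * q) • lieD (k + 1) (by omega) u β
          + (-1 : ℝ) ^ q • lieD (k + 1) (by omega) v (extD α)
          - ((-1 : ℝ) ^ q / 2) • extD (iota hqk v (extD α) + (-1 : ℝ) ^ (1 * q) •
            iota (Nat.add_comm 1 k) u β) →
      θ x = lieDVec (fun x => toVec (u x)) β x := by
    rintro θ rfl
    simp only [Pi.sub_apply, Pi.add_apply, Pi.smul_apply]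
    rw [h2, h4, h5]
    simp only [Nat.sub_self, zero_mul, pow_zero, one_smul, smul_smul]
    rw [add_sub_assoc, ← sub_smul]
    ring_nf
    simp
  have h6 := hθ _ rfl
  refine ⟨h6 ▸ h, ?_⟩
  rw [← hs]
  congr 1
  exact Subtype.ext h6.symm

end RegularGradedDirac

end Brackets

/-! ### The extended bracket -/

section Theorem

variable {E : Type*} [NormedAddCommGroup E] [NormedSpace ℝ E] [FiniteDimensional ℝ E]
  {M : Type*} [TopologicalSpace M] [ChartedSpace E M] [IsManifold 𝓘(ℝ, E) ∞ M]

namespace RegularGradedDirac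

variable {m : ℕ} {D : RegularGradedDirac E M (m + 1)} {U : Set M}

omit [IsManifold 𝓘(ℝ, E) ∞ M] in
/-- `S^{c+1} ⊆ (S¹)^{∧(c+1)}`: an element of `S^{c+1}` contracted with `c` vectors lies in `S¹`. -/
theorem mem_wedgePow_of_mem {x : M} {c : ℕ} (hc : c + 1 ≤ m + 1)
    {β : (TangentSpace 𝓘(ℝ, E) x) [⋀^Fin (c + 1)]→ₗ[ℝ] ℝ} (hβ : β ∈ D.S (c + 1) x) :
    β ∈ wedgePow (D.S 1 x) (c + 1) := by
  induction c with
  | zero =>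
    rw [mem_wedgePow_succ_iff]
    intro X hX
    ext v
    refine Eq.trans ?_ (mem_kerVec.1 hX β hβ)
    rw [AlternatingMap.curryLeft_apply_apply]
    congr 1
    funext i
    rw [Subsingleton.elim i 0]
    rfl
  | succ c ih =>
    rw [mem_wedgePow_succ_iff]
    intro X hX
    refine eq_zero_of_curryLeft fun Y => ?_
    have h1 : β.curryLeft Y ∈ D.S (c + 1) x := by
      rw [D.contraction (c + 1) (by omega) (by omega) x]
      exact Submodule.subset_span ⟨Y, β, hβ, rfl⟩
    rw [curryLeft_anticomm, mem_wedgePow_succ_iff.1 (ih (by omega) h1) X hX]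
    exact neg_zero

omit [IsManifold 𝓘(ℝ, E) ∞ M] in
/-- Any vector that represents `♯_n(dα)` may be used in `{Θ, α} = ι_X dΘ`. -/
theorem poissonTop_eq_of_sub_mem {a : ℕ} {α : FormField E M m} {Θ : FormField E M a} {y : M}
    (hΘ : extD Θ y ∈ wedgePow (D.S 1 y) (a + 1)) {X : (x : M) → TangentSpace 𝓘(ℝ, E) x}
    (hX : X y - D.hamVec α y ∈ kerVec (D.S 1 y)) :
    D.poissonTop Θ α y = iotaVec X (extD Θ) y := by
  rw [poissonTop_eq]
  exact (curryLeft_eq_of_sub_mem_kerVec hΘ hX).symm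

theorem IsHamiltonianOne.smooth_poissonTop (hU : IsOpen U) {a : ℕ} {α : FormField E M m}
    {Θ : FormField E M a} (hα : D.IsHamiltonian U α) (hΘ : D.IsHamiltonianOne U Θ) :
    SmoothForm U (D.poissonTop Θ α) := by
  refine SmoothForm.of_locally fun x hx => ?_
  obtain ⟨W, hW, hxW, hWU, u, hus, hu⟩ := hα.exists_smooth_rep hU hx
  exact ⟨W, hW, hxW, _, (hΘ.1.extD.mono hWU).iotaVec hus.smoothVec, fun y hy =>
    poissonTop_eq_of_sub_mem (hΘ.2 y (hWU hy)) (D.sub_hamVec_mem_kerVec _ (hu y hy))⟩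

/-- `d{Θ, α} = £_X dΘ` for a local Hamiltonian vector field `X` of `α`. -/
theorem extD_poissonTop {a : ℕ} {α : FormField E M m} {Θ : FormField E M a} {W : Set M}
    (hW : IsOpen W) (hΘ : D.IsHamiltonianOne W Θ) {X : (x : M) → TangentSpace 𝓘(ℝ, E) x}
    (hX : ∀ y ∈ W, X y - D.hamVec α y ∈ kerVec (D.S 1 y)) {x : M} (hx : x ∈ W) :
    extD (D.poissonTop Θ α) x = lieDVec X (extD Θ) x := by
  rw [extD_congr (Filter.eventually_of_mem (hW.mem_nhds hx) fun y hy =>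
    poissonTop_eq_of_sub_mem (hΘ.2 y hy) (hX y hy)), lieDVec, Pi.add_apply]
  refine (add_zero _).symm.trans (congrArg₂ _ rfl ?_)
  rw [iotaVec, extD_extD (hΘ.1 x hx)]
  rfl

/-- Infinitesimally, a Hamiltonian vector field preserves `S¹`, hence the annihilator of `S¹`, hence
the forms killed by this annihilator. Here `d{Θ, α} = £_X dΘ`. -/
theorem isHamiltonianOne_poissonTop (hU : IsOpen U) {a : ℕ} {α : FormField E M m}
    {Θ : FormField E M a} (hα : D.IsHamiltonian U α) (hΘ : D.IsHamiltonianOne U Θ) :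
    D.IsHamiltonianOne U (D.poissonTop Θ α) := by
  refine ⟨hΘ.smooth_poissonTop hU hα, fun x hx => ?_⟩
  obtain ⟨W, hW, hxW, hWU, u, hus, hu⟩ := hα.exists_smooth_rep hU hx
  obtain ⟨W', hW', hxW', r, σ, hσ, hS⟩ := D.isSubbundle 1 le_rfl (Nat.le_add_left 1 m) x
  have hΘW : D.IsHamiltonianOne W Θ := ⟨hΘ.1.mono hWU, fun y hy => hΘ.2 y (hWU hy)⟩
  rw [extD_poissonTop hW hΘW (fun y hy => D.sub_hamVec_mem_kerVec _ (hu y hy)) hxW,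
    mem_wedgePow_succ_iff]
  intro v hv
  refine curryLeft_lieDVec_eq_zero (hW.inter hW') ⟨hxW, hxW'⟩ (σ := σ) (S := D.S 1)
    (fun i => (hσ i).mono Set.inter_subset_right) (fun y hy => hS y hy.2)
    (hus.mono Set.inter_subset_left).smoothVec (hΘW.1.extD.mono Set.inter_subset_left)
    (fun y hy Y hY => mem_wedgePow_succ_iff.1 (hΘW.2 y hy.1) Y hY) (fun i => ?_) hv
  have hσS : ∀ y ∈ W', σ i y ∈ D.S (0 + 1) y := by
    intro y hy
    change σ i y ∈ D.S 1 y
    rw [(hS y hy).2]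
    exact Submodule.subset_span ⟨i, rfl⟩
  obtain ⟨W'', hW'', hxW'', hsub, v, hvs, hv⟩ := D.sharp_smooth (p := m + 1) (Nat.le_add_left 1 0)
    (Nat.le_add_left 1 m) (by omega) W' hW' (σ i) (hσ i) hσS x hxW'
  exact (D.lieDVec_mem (Nat.le_add_left 1 m) (Nat.add_zero (m + 1)) (hW.inter hW'')
    (hα.mono (Set.inter_subset_left.trans hWU)) ((hσ i).mono (Set.inter_subset_right.trans hsub))
    (fun y hy => hσS y (hsub hy.2)) (hus.mono Set.inter_subset_left)
    (hvs.mono Set.inter_subset_right) (fun y hy => hu y hy.1) (fun y hy => hv y hy.2)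
    x ⟨hxW, hxW''⟩).1

omit [IsManifold 𝓘(ℝ, E) ∞ M] in
/-- On `U` the extended bracket is minus the bracket with the arguments exchanged. -/
theorem extBracket_eq_neg {a : ℕ} {α : FormField E M m} {Θ : FormField E M a}
    (hα : D.IsHamiltonian U α) (hΘ : D.IsHamiltonianOne U Θ) {x : M} (hx : x ∈ U) :
    D.extBracket α Θ x = -D.poissonTop Θ α x := by
  rw [D.extBracket_apply (hα.2 x hx) (hΘ.2 x hx), poissonTop_eq]
  rfl

omit [IsManifold 𝓘(ℝ, E) ∞ M] in
theorem IsHamiltonianOne.congr {a : ℕ} {Θ Θ' : FormField E M a} (hU : IsOpen U)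
    (hΘ : D.IsHamiltonianOne U Θ) (h : ∀ x ∈ U, Θ x = Θ' x) : D.IsHamiltonianOne U Θ' :=
  ⟨hΘ.1.congr hU h, fun x hx => by
    rw [← extD_congr (Filter.eventually_of_mem (hU.mem_nhds hx) h)]
    exact hΘ.2 x hx⟩

omit [IsManifold 𝓘(ℝ, E) ∞ M] in
theorem IsHamiltonianOne.neg {a : ℕ} {Θ : FormField E M a} (hΘ : D.IsHamiltonianOne U Θ) :
    D.IsHamiltonianOne U (-Θ) :=
  ⟨hΘ.1.neg, fun x hx => by
    rw [extD_neg]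
    exact neg_mem (hΘ.2 x hx)⟩

theorem isHamiltonianOne_extBracket (hU : IsOpen U) {a : ℕ} {α : FormField E M m}
    {Θ : FormField E M a} (hα : D.IsHamiltonian U α) (hΘ : D.IsHamiltonianOne U Θ) :
    D.IsHamiltonianOne U (D.extBracket α Θ) :=
  (isHamiltonianOne_poissonTop hU hα hΘ).neg.congr hU fun _ hx => (extBracket_eq_neg hα hΘ hx).symm

omit [IsManifold 𝓘(ℝ, E) ∞ M] in
theorem IsHamiltonian.isHamiltonianOne {b : ℕ} (hb : b ≤ m) {Θ : FormField E M b}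
    (hΘ : D.IsHamiltonian U Θ) : D.IsHamiltonianOne U Θ :=
  ⟨hΘ.1, fun x hx => mem_wedgePow_of_mem (by omega) (hΘ.2 x hx)⟩

/-- For Hamiltonian `(n-1)`-forms, `♯_n d{α, β}` is represented by the Schouten-Nijenhuis bracket of
local Hamiltonian vector fields of `β` and `α`. -/
theorem sharp_extD_poissonTop {α β : FormField E M m} {W : Set M} (hW : IsOpen W)
    (hα : D.IsHamiltonian W α) (hβ : D.IsHamiltonian W β) {u v : MultivectorField E M 1}
    (hus : SmoothMultivector W u) (hvs : SmoothMultivector W v)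
    (hu : ∀ y (hy : y ∈ W), D.sharp (p := 1) (Nat.le_add_left 1 m) le_rfl rfl y
      ⟨extD β y, hβ.2 y hy⟩ = Submodule.Quotient.mk (u y))
    (hv : ∀ y (hy : y ∈ W), D.sharp (p := 1) (Nat.le_add_left 1 m) le_rfl rfl y
      ⟨extD α y, hα.2 y hy⟩ = Submodule.Quotient.mk (v y)) {x : M} (hx : x ∈ W) :
    ∃ h : extD (D.poissonTop α β) x ∈ D.S (m + 1) x,
      D.sharp (p := 1) (Nat.le_add_left 1 m) le_rfl rfl x ⟨_, h⟩
        = Submodule.Quotient.mk (schouten le_rfl rfl u v x) := by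
  have h := D.lieDVec_mem le_rfl (Nat.add_comm 1 m) hW hβ hα.1.extD hα.2 hus hvs hu hv x hx
  rw [← extD_poissonTop hW (hα.isHamiltonianOne le_rfl)
    (fun y hy => D.sub_hamVec_mem_kerVec _ (hu y hy)) hx] at h
  exact h

theorem isHamiltonian_poissonTop (hU : IsOpen U) {α β : FormField E M m}
    (hα : D.IsHamiltonian U α) (hβ : D.IsHamiltonian U β) :
    D.IsHamiltonian U (D.poissonTop α β) := by
  refine ⟨(hα.isHamiltonianOne le_rfl).smooth_poissonTop hU hβ, fun x hx => ?_⟩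
  obtain ⟨W, hW, hxW, hWU, u, hus, hu⟩ := hβ.exists_smooth_rep hU hx
  obtain ⟨W', hW', hxW', hWU', v, hvs, hv⟩ := hα.exists_smooth_rep hU hx
  exact (sharp_extD_poissonTop (hW.inter hW') (hα.mono (Set.inter_subset_left.trans hWU))
    (hβ.mono (Set.inter_subset_left.trans hWU)) (hus.mono Set.inter_subset_left)
    (hvs.mono Set.inter_subset_right) (fun y hy => hu y hy.1) (fun y hy => hv y hy.2)
    ⟨hxW, hxW'⟩).1

omit [IsManifold 𝓘(ℝ, E) ∞ M] in
/-- By skew-symmetry of the maps `♯_a`, the extended bracket is the Poisson bracket on Hamiltonian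
forms. -/
theorem extBracket_eq_poisson {b p : ℕ} (hp : 1 ≤ p) (hbp : (b + 1) + p = (m + 1) + 1)
    (hk : p + b = m + 1) {α : FormField E M m} {Θ : FormField E M b} {x : M}
    (hα : extD α x ∈ D.S (m + 1) x) (hΘ : extD Θ x ∈ D.S (b + 1) x) :
    D.extBracket α Θ x = D.poisson hp hbp hk α Θ x := by
  rw [D.extBracket_apply hα (mem_wedgePow_of_mem (by omega) hΘ), poisson, dif_pos hΘ]
  have hskew := D.skew (k := b) (Nat.le_add_left 1 m) (Nat.le_add_left 1 b) le_rfl hp rfl hbp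
    (Nat.add_comm 1 b) hk x ⟨extD α x, hα⟩ ⟨extD Θ x, hΘ⟩ (Quotient.out _) (Quotient.out _)
    (Quotient.out_eq _).symm (Quotient.out_eq _).symm
  have h1 : contract (Nat.add_comm 1 b) (Quotient.out
      (D.sharp (p := 1) (Nat.le_add_left 1 m) le_rfl rfl x ⟨extD α x, hα⟩)) (extD Θ x)
      = (extD Θ x).curryLeft (D.hamVec α x) := by
    rw [hamVec, dif_pos hα]
    exact contract_one _ _ _
  have h2 : (-1 : ℝ) ^ degH (m + 1) b = -(-1 : ℝ) ^ (1 * p) := by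
    rw [degH, show (((m + 1 : ℕ) : ℤ) - 1 - b) = (p : ℤ) - 1 by omega,
      zpow_sub_one₀ (by norm_num), zpow_natCast, one_mul]
    norm_num
  rw [← h1, hskew, h2]
  exact (neg_smul (_ : ℝ) (_ : (TangentSpace 𝓘(ℝ, E) x) [⋀^Fin b]→ₗ[ℝ] ℝ)).symm

/-- `d ι_X Θ = -ι_X dΘ` if `£_X Θ = 0`. -/
theorem isHamiltonianOne_iotaVec (hU : IsOpen U) {a : ℕ} {Θ : FormField E M (a + 1)}
    {X : (x : M) → TangentSpace 𝓘(ℝ, E) x} (hΘ : D.IsHamiltonianOne U Θ)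
    (hX : SmoothVectorField U X) (hL : ∀ x ∈ U, lieDVec X Θ x = 0) :
    D.IsHamiltonianOne U (iotaVec X Θ) := by
  refine ⟨hΘ.1.iotaVec (hX.smoothVec hU), fun x hx => ?_⟩
  rw [eq_neg_of_add_eq_zero_left (hL x hx)]
  exact neg_mem (curryLeft_mem_wedgePow (hΘ.2 x hx) (X x))

theorem extBracket_iotaVec (hU : IsOpen U) {a : ℕ} {α : FormField E M m}
    {Θ : FormField E M (a + 1)} {X : (x : M) → TangentSpace 𝓘(ℝ, E) x}
    (hα : D.IsHamiltonian U α) (hΘ : D.IsHamiltonianOne U Θ)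
    (hX : SmoothVectorField U X) (hL : ∀ x ∈ U, lieDVec X Θ x = 0) {x : M} (hx : x ∈ U) :
    D.extBracket α (iotaVec X Θ) x = iotaVec X (D.extBracket α Θ) x := by
  have h1 : extD (iotaVec X Θ) x = -(extD Θ x).curryLeft (X x) :=
    eq_neg_of_add_eq_zero_left (hL x hx)
  rw [D.extBracket_apply (hα.2 x hx) ((isHamiltonianOne_iotaVec hU hΘ hX hL).2 x hx), h1, iotaVec,
    D.extBracket_apply (hα.2 x hx) (hΘ.2 x hx)]
  refine (neg_neg _).trans ((curryLeft_anticomm (extD Θ x) (X x) (D.hamVec α x)).trans rfl)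

/-- `d(Θ₁ ∧ dΘ₂) = dΘ₁ ∧ dΘ₂`. -/
theorem extD_wedgeForm_extD {a₁ a₂ : ℕ} {Θ₁ : FormField E M a₁} {Θ₂ : FormField E M a₂} {x : M}
    (h₁ : ContDiffAt ℝ ∞ (formInChart x Θ₁) (chartAt E x x))
    (h₂ : ContDiffAt ℝ ∞ (formInChart x Θ₂) (chartAt E x x))
    (h₂' : ContDiffAt ℝ ∞ (formInChart x (extD Θ₂)) (chartAt E x x)) :
    extD (wedgeForm rfl Θ₁ (extD Θ₂)) x
      = wedge (by omega : a₁ + 1 + (a₂ + 1) = a₁ + (a₂ + 1) + 1) (extD Θ₁ x) (extD Θ₂ x) := by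
  rw [extD_wedgeForm rfl (by omega) (by omega) h₁ h₂', extD_extD h₂, wedge_zero, smul_zero, add_zero]

theorem isHamiltonianOne_wedgeForm {a₁ a₂ : ℕ} {Θ₁ : FormField E M a₁} {Θ₂ : FormField E M a₂}
    (h₁ : D.IsHamiltonianOne U Θ₁) (h₂ : D.IsHamiltonianOne U Θ₂) :
    D.IsHamiltonianOne U (wedgeForm rfl Θ₁ (extD Θ₂)) := by
  refine ⟨h₁.1.wedgeForm rfl h₂.1.extD, fun x hx => ?_⟩
  rw [extD_wedgeForm_extD (h₁.1 x hx) (h₂.1 x hx) (h₂.1.extD x hx)]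
  exact wedge_mem_wedgePow _ (h₁.2 x hx) (h₂.2 x hx)

theorem extBracket_wedgeForm {a₁ a₂ : ℕ} (h : a₁ + 1 + a₂ = a₁ + (a₂ + 1))
    {α : FormField E M m} {Θ₁ : FormField E M a₁} {Θ₂ : FormField E M a₂} (hα : D.IsHamiltonian U α)
    (h₁ : D.IsHamiltonianOne U Θ₁) (h₂ : D.IsHamiltonianOne U Θ₂) {x : M} (hx : x ∈ U) :
    D.extBracket α (wedgeForm rfl Θ₁ (extD Θ₂)) x
      = wedge rfl (D.extBracket α Θ₁ x) (extD Θ₂ x)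
        + (-1 : ℝ) ^ (a₁ + 1) •
          wedge h (extD Θ₁ x) (D.extBracket α Θ₂ x) := by
  rw [D.extBracket_apply (hα.2 x hx) ((isHamiltonianOne_wedgeForm h₁ h₂).2 x hx),
    extD_wedgeForm_extD (h₁.1 x hx) (h₂.1 x hx) (h₂.1.extD x hx),
    D.extBracket_apply (hα.2 x hx) (h₁.2 x hx), D.extBracket_apply (hα.2 x hx) (h₂.2 x hx),
    curryLeft_wedge _ rfl h, neg_wedge, wedge_neg]
  ext w
  simp
  ring

/-! ### The Jacobi identity -/

/-- The vector-field part of the Jacobi identity: with local Hamiltonian vector fields `X`, `Y` of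
`β`, `α`, the vector `[X, Y]` represents `♯_n d{α, β}` and satisfies
`ι_{[X, Y]} dΘ = £_X ι_Y dΘ - ι_Y £_X dΘ`. -/
theorem exists_local_jacobi (hU : IsOpen U) {α β : FormField E M m}
    (hα : D.IsHamiltonian U α) (hβ : D.IsHamiltonian U β) {x : M} (hx : x ∈ U) :
    ∃ W, IsOpen W ∧ x ∈ W ∧ W ⊆ U ∧ ∃ X Y : (x : M) → TangentSpace 𝓘(ℝ, E) x,
      SmoothVec W X ∧ SmoothVec W Y ∧
      (∀ y ∈ W, X y - D.hamVec β y ∈ kerVec (D.S 1 y)) ∧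
      (∀ y ∈ W, Y y - D.hamVec α y ∈ kerVec (D.S 1 y)) ∧
      (∀ (a : ℕ) (ξ : FormField E M (a + 2)), SmoothForm W ξ →
        ξ x ∈ wedgePow (D.S 1 x) (a + 2) →
        (ξ x).curryLeft (D.hamVec (D.poissonTop α β) x)
          = lieDVec X (iotaVec Y ξ) x - (lieDVec X ξ x).curryLeft (Y x)) ∧
      (∀ ξ : FormField E M 1, SmoothForm W ξ → ξ x ∈ wedgePow (D.S 1 x) 1 →
        (ξ x).curryLeft (D.hamVec (D.poissonTop α β) x)
          = (extD (iotaVec Y ξ) x).curryLeft (X x) - (lieDVec X ξ x).curryLeft (Y x)) := by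
  obtain ⟨W, hW, hxW, hWU, u, hus, hu⟩ := hβ.exists_smooth_rep hU hx
  obtain ⟨W', hW', hxW', hWU', v, hvs, hv⟩ := hα.exists_smooth_rep hU hx
  have hWW : W ∩ W' ⊆ U := Set.inter_subset_left.trans hWU
  replace hus := hus.mono (Set.inter_subset_left (t := W'))
  replace hvs := hvs.mono (Set.inter_subset_right (s := W))
  obtain ⟨h, hs⟩ := sharp_extD_poissonTop (hW.inter hW') (hα.mono hWW) (hβ.mono hWW) hus hvs
    (fun y hy => hu y hy.1) (fun y hy => hv y hy.2) ⟨hxW, hxW'⟩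
  have hxWW : x ∈ W ∩ W' := ⟨hxW, hxW'⟩
  obtain ⟨b, hb, hb'⟩ := exists_bracket (hus.smoothVec x hxWW) (hvs.smoothVec x hxWW)
  have hker₁ := D.sub_hamVec_mem_kerVec h hs
  -- the Schouten bracket and `b` have the same pairing with a frame of `S¹`
  have hker₂ : toVec (schouten le_rfl rfl u v x : ⋀[ℝ]^1 (TangentSpace 𝓘(ℝ, E) x)) - b
      ∈ kerVec (D.S 1 x) := by
    obtain ⟨W₁, hW₁, hxW₁, r, σ, hσ, hS⟩ := D.isSubbundle 1 le_rfl (Nat.le_add_left 1 m) x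
    rw [mem_kerVec, (hS x hxW₁).2]
    intro τ hτ
    induction hτ using Submodule.span_induction with
    | mem τ hτ =>
      obtain ⟨i, rfl⟩ := hτ
      have h3 := (curryLeft_schouten hxWW hus hvs hW₁ hxW₁ (hσ i)).trans
        (hb' (σ i) (hσ i x hxW₁)).symm
      have h4 : (σ i x).curryLeft (toVec (schouten le_rfl rfl u v x :
          ⋀[ℝ]^1 (TangentSpace 𝓘(ℝ, E) x)) - b) = 0 := by
        rw [map_sub, h3, sub_self]
      have h5 := DFunLike.congr_fun h4 (fun i => i.elim0)
      rw [AlternatingMap.curryLeft_apply_apply] at h5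
      refine Eq.trans ?_ h5
      congr 1
      funext j
      rw [Subsingleton.elim j 0]
      rfl
    | zero => rfl
    | add τ τ' _ _ h h' => rw [AlternatingMap.add_apply, h, h', add_zero]
    | smul c τ _ h => rw [AlternatingMap.smul_apply, h, smul_zero]
  have hker : b - D.hamVec (D.poissonTop α β) x ∈ kerVec (D.S 1 x) := by
    have := sub_mem hker₁ hker₂
    rwa [sub_sub_sub_cancel_left] at this
  refine ⟨W ∩ W', hW.inter hW', hxWW, hWW, fun x => toVec (u x), fun x => toVec (v x),
    hus.smoothVec, hvs.smoothVec, fun y hy => D.sub_hamVec_mem_kerVec _ (hu y hy.1),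
    fun y hy => D.sub_hamVec_mem_kerVec _ (hv y hy.2), fun a ξ hξ hξS => ?_, fun ξ hξ hξS => ?_⟩
  · rw [← curryLeft_eq_of_sub_mem_kerVec hξS hker, hb a ξ (hξ x hxWW)]
  · rw [← curryLeft_eq_of_sub_mem_kerVec hξS hker, hb' ξ (hξ x hxWW)]

/-- The cyclic sum of the Jacobi identity, in terms of exterior derivatives and contractions. -/
theorem jacobi_sum_apply (hU : IsOpen U) {a : ℕ} {α β : FormField E M m} {Θ : FormField E M a}
    (hα : D.IsHamiltonian U α) (hβ : D.IsHamiltonian U β) (hΘ : D.IsHamiltonianOne U Θ) {x : M}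
    (hx : x ∈ U) :
    (D.extBracket α (D.extBracket β Θ) + D.poissonTop Θ (D.poissonTop α β)
        + D.extBracket β (D.poissonTop Θ α)) x
      = (extD (D.poissonTop Θ β) x).curryLeft (D.hamVec α x)
        + (extD Θ x).curryLeft (D.hamVec (D.poissonTop α β) x)
        - (extD (D.poissonTop Θ α) x).curryLeft (D.hamVec β x) := by
  have h1 : extD (D.extBracket β Θ) x = -extD (D.poissonTop Θ β) x := by
    rw [extD_congr (η := -D.poissonTop Θ β) (Filter.eventually_of_mem (hU.mem_nhds hx)
      fun y hy => extBracket_eq_neg hβ hΘ hy), extD_neg]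
    rfl
  rw [Pi.add_apply, Pi.add_apply,
    D.extBracket_apply (hα.2 x hx) ((isHamiltonianOne_extBracket hU hβ hΘ).2 x hx), h1,
    D.extBracket_apply (hβ.2 x hx) ((isHamiltonianOne_poissonTop hU hα hΘ).2 x hx),
    D.poissonTop_eq Θ (D.poissonTop α β), sub_eq_add_neg]
  exact congrArg₂ _ (congrArg₂ _ (by ext w; exact neg_neg _) rfl) rfl

theorem isExactForm_jacobi_sum (hU : IsOpen U) {a : ℕ} {α β : FormField E M m}
    {Θ : FormField E M a} (hα : D.IsHamiltonian U α) (hβ : D.IsHamiltonian U β)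
    (hΘ : D.IsHamiltonianOne U Θ) :
    IsExactForm U (D.extBracket α (D.extBracket β Θ) + D.poissonTop Θ (D.poissonTop α β)
        + D.extBracket β (D.poissonTop Θ α)) := by
  have hP := isHamiltonianOne_poissonTop hU hβ hΘ
  have hQ := isHamiltonianOne_poissonTop hU hα hΘ
  -- `d{Θ, γ} = d ι_X dΘ = £_X dΘ` for a local Hamiltonian vector field `X` of `γ`
  have hloc : ∀ {x : M} {W : Set M} {X : (x : M) → TangentSpace 𝓘(ℝ, E) x} {γ : FormField E M m},
      IsOpen W → x ∈ W → W ⊆ U → (∀ y ∈ W, X y - D.hamVec γ y ∈ kerVec (D.S 1 y)) →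
      extD (D.poissonTop Θ γ) x = extD (iotaVec X (extD Θ)) x ∧
      lieDVec X (extD Θ) x = extD (D.poissonTop Θ γ) x := by
    intro x W X γ hW hxW hWU hX
    have hΘW : D.IsHamiltonianOne W Θ := ⟨hΘ.1.mono hWU, fun y hy => hΘ.2 y (hWU hy)⟩
    exact ⟨extD_congr (Filter.eventually_of_mem (hW.mem_nhds hxW) fun y hy =>
      poissonTop_eq_of_sub_mem (hΘW.2 y hy) (hX y hy)), (extD_poissonTop hW hΘW hX hxW).symm⟩
  cases a with
  | zero =>
    intro x hx
    obtain ⟨W, hW, hxW, hWU, X, Y, hXs, hYs, hX, hY, -, hbr⟩ := exists_local_jacobi hU hα hβ hx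
    rw [jacobi_sum_apply hU hα hβ hΘ hx, hbr _ (hΘ.1.extD.mono hWU) (hΘ.2 x hx),
      (hloc hW hxW hWU hX).2, ← (hloc hW hxW hWU hY).1,
      curryLeft_eq_of_sub_mem_kerVec (hP.2 x hx) (hY x hxW),
      curryLeft_eq_of_sub_mem_kerVec (hQ.2 x hx) (hX x hxW)]
    abel
  | succ a =>
    -- the primitive is `ι_X ι_Y dΘ`, for Hamiltonian vector fields `X` of `β` and `Y` of `α`
    refine ⟨iotaVec (D.hamVec β) (D.poissonTop Θ α), ?_, ?_⟩
    all_goals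
      have hη : ∀ {W : Set M} {X Y : (x : M) → TangentSpace 𝓘(ℝ, E) x}, W ⊆ U →
          (∀ y ∈ W, X y - D.hamVec β y ∈ kerVec (D.S 1 y)) →
          (∀ y ∈ W, Y y - D.hamVec α y ∈ kerVec (D.S 1 y)) → ∀ y ∈ W,
          iotaVec (D.hamVec β) (D.poissonTop Θ α) y = iotaVec X (iotaVec Y (extD Θ)) y := by
        intro W X Y hWU hX hY y hy
        have h1 := curryLeft_mem_wedgePow (hΘ.2 y (hWU hy)) (Y y)
        rw [iotaVec, poissonTop_eq_of_sub_mem (hΘ.2 y (hWU hy)) (hY y hy)]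
        exact (curryLeft_eq_of_sub_mem_kerVec h1 (hX y hy)).symm
    · refine SmoothForm.of_locally fun x hx => ?_
      obtain ⟨W, hW, hxW, hWU, X, Y, hXs, hYs, hX, hY, -⟩ := exists_local_jacobi hU hα hβ hx
      exact ⟨W, hW, hxW, _, ((hΘ.1.extD.mono hWU).iotaVec hYs).iotaVec hXs, hη hWU hX hY⟩
    · intro x hx
      obtain ⟨W, hW, hxW, hWU, X, Y, hXs, hYs, hX, hY, hbr, -⟩ := exists_local_jacobi hU hα hβ hx
      have h2 : lieDVec X (iotaVec Y (extD Θ)) x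
          = extD (iotaVec X (iotaVec Y (extD Θ))) x
            + (extD (iotaVec Y (extD Θ)) x).curryLeft (X x) := rfl
      rw [jacobi_sum_apply hU hα hβ hΘ hx, hbr _ _ (hΘ.1.extD.mono hWU) (hΘ.2 x hx),
        extD_congr (Filter.eventually_of_mem (hW.mem_nhds hxW) (hη hWU hX hY)), h2,
        (hloc hW hxW hWU hX).2, ← (hloc hW hxW hWU hY).1,
        curryLeft_eq_of_sub_mem_kerVec (hP.2 x hx) (hY x hxW),
        curryLeft_eq_of_sub_mem_kerVec (hQ.2 x hx) (hX x hxW)]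
      abel

end RegularGradedDirac

end Theorem

end GradedDirac

end

theorem mainTheorem1
    {E : Type*} [NormedAddCommGroup E] [NormedSpace ℝ E] [FiniteDimensional ℝ E]
    {M : Type*} [TopologicalSpace M] [T2Space M] [SigmaCompactSpace M] [ChartedSpace E M]
    [IsManifold 𝓘(ℝ, E) ∞ M]
    -- a regular graded Dirac structure of order `n = m + 1`, and an open set
    (m : ℕ) (D : GradedDirac.RegularGradedDirac E M (m + 1)) (U : Set M) (hU : IsOpen U) :
    -- the brackets take values in the right spaces, and the first one extends the Poisson bracket
    (∀ (a : ℕ) (α : GradedDirac.FormField E M m) (Θ : GradedDirac.FormField E M a),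
      D.IsHamiltonian U α → D.IsHamiltonianOne U Θ →
        D.IsHamiltonianOne U (D.extBracket α Θ) ∧ D.IsHamiltonianOne U (D.poissonTop Θ α)) ∧
    (∀ (α β : GradedDirac.FormField E M m),
      D.IsHamiltonian U α → D.IsHamiltonian U β → D.IsHamiltonian U (D.poissonTop α β)) ∧
    (∀ (b p : ℕ) (hp : 1 ≤ p) (hbp : (b + 1) + p = (m + 1) + 1) (hk : p + b = m + 1)
      (α : GradedDirac.FormField E M m) (Θ : GradedDirac.FormField E M b),
      D.IsHamiltonian U α → D.IsHamiltonian U Θ →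
        D.IsHamiltonianOne U Θ ∧
        ∀ x ∈ U, D.extBracket α Θ x = D.poisson hp hbp hk α Θ x) ∧
    -- (i) graded skew-symmetry
    (∀ (a : ℕ) (α : GradedDirac.FormField E M m) (Θ : GradedDirac.FormField E M a),
      D.IsHamiltonian U α → D.IsHamiltonianOne U Θ →
        ∀ x ∈ U, D.extBracket α Θ x =
          -((-1 : ℝ) ^ (GradedDirac.degH (m + 1) m * GradedDirac.degH (m + 1) a) •
            D.poissonTop Θ α x)) ∧
    -- (ii) invariance by symmetries
    (∀ (a : ℕ) (α : GradedDirac.FormField E M m) (Θ : GradedDirac.FormField E M (a + 1))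
      (X : (x : M) → TangentSpace 𝓘(ℝ, E) x),
      D.IsHamiltonian U α → D.IsHamiltonianOne U Θ → GradedDirac.SmoothVectorField U X →
      (∀ x ∈ U, GradedDirac.lieDVec X Θ x = 0) →
        D.IsHamiltonianOne U (GradedDirac.iotaVec X Θ) ∧
        ∀ x ∈ U, D.extBracket α (GradedDirac.iotaVec X Θ) x =
          GradedDirac.iotaVec X (D.extBracket α Θ) x) ∧
    -- (iii) Jacobi identity up to an exact form
    (∀ (a : ℕ) (α β : GradedDirac.FormField E M m) (Θ : GradedDirac.FormField E M a),
      D.IsHamiltonian U α → D.IsHamiltonian U β → D.IsHamiltonianOne U Θ →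
        GradedDirac.IsExactForm U
          (D.extBracket α (D.extBracket β Θ)
            + D.poissonTop Θ (D.poissonTop α β)
            + D.extBracket β (D.poissonTop Θ α))) ∧
    -- (iv) Leibniz identity
    (∀ (a₁ a₂ : ℕ) (α : GradedDirac.FormField E M m) (Θ₁ : GradedDirac.FormField E M a₁)
      (Θ₂ : GradedDirac.FormField E M a₂),
      D.IsHamiltonian U α → D.IsHamiltonianOne U Θ₁ → D.IsHamiltonianOne U Θ₂ →
        D.IsHamiltonianOne U (GradedDirac.wedgeForm rfl Θ₁ (GradedDirac.extD Θ₂)) ∧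
        ∀ x ∈ U,
          D.extBracket α (GradedDirac.wedgeForm rfl Θ₁ (GradedDirac.extD Θ₂)) x =
            GradedDirac.wedge rfl (D.extBracket α Θ₁ x) (GradedDirac.extD Θ₂ x)
            + (-1 : ℝ) ^ (a₁ + 1) •
              GradedDirac.wedge (by omega) (GradedDirac.extD Θ₁ x) (D.extBracket α Θ₂ x)) := by
  refine ⟨fun a α Θ hα hΘ => ⟨?_, ?_⟩, fun α β hα hβ => ?_, fun b p hp hbp hk α Θ hα hΘ =>
    ⟨?_, fun x hx => ?_⟩, fun a α Θ hα hΘ x hx => ?_, fun a α Θ X hα hΘ hX hL =>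
    ⟨?_, fun x hx => ?_⟩, fun a α β Θ hα hβ hΘ => ?_, fun a₁ a₂ α Θ₁ Θ₂ hα h₁ h₂ =>
    ⟨?_, fun x hx => ?_⟩⟩
  · exact GradedDirac.RegularGradedDirac.isHamiltonianOne_extBracket hU hα hΘ
  · exact GradedDirac.RegularGradedDirac.isHamiltonianOne_poissonTop hU hα hΘ
  · exact GradedDirac.RegularGradedDirac.isHamiltonian_poissonTop hU hα hβ
  · exact hΘ.isHamiltonianOne (by omega)
  · exact GradedDirac.RegularGradedDirac.extBracket_eq_poisson hp hbp hk (hα.2 x hx) (hΘ.2 x hx)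
  · have hd : GradedDirac.degH (m + 1) m = 0 := by simp [GradedDirac.degH]
    rw [GradedDirac.RegularGradedDirac.extBracket_eq_neg hα hΘ hx, hd, zero_mul, zpow_zero,
      one_smul]
  · exact GradedDirac.RegularGradedDirac.isHamiltonianOne_iotaVec hU hΘ hX hL
  · exact GradedDirac.RegularGradedDirac.extBracket_iotaVec hU hα hΘ hX hL hx
  · exact GradedDirac.RegularGradedDirac.isExactForm_jacobi_sum hU hα hβ hΘ
  · exact GradedDirac.RegularGradedDirac.isHamiltonianOne_wedgeForm h₁ h₂
  · exact GradedDirac.RegularGradedDirac.extBracket_wedgeForm _ hα h₁ h₂ hx
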